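/- Let $R$ be a commutative ring with unit. Let $N$ be the normalization functor from simplicial $R$-modules to non-negatively graded chain complexes of $R$-modules, $N_n(A_\bullet)=\bigcap_{i=1}^n\ker(d_i\colon A_n\to A_{n-1})$ with differential $d_0$, and let $\Gamma$ be its inverse in the Dold–Kan equivalence. Let $\hat\otimes$ be the degreewise tensor product of simplicial $R$-modules, with unit the constant simplicial module $\underline R$ and twist $\hat\tau(a\otimes b)=b\otimes a$. Transport this symmetric monoidal structure along the equivalence: $C_*\tilde\otimes C'_*=N(\Gamma(C_*)\hat\otimes\Gamma(C'_*))$, with unit $N(\underline R)$ and twist $\tilde\tau=N(\hat\tau)$. Let $C_*$ be a commutative monoid in $(\mathsf{Ch}^R_{\geqslant 0},\tilde\otimes,N(\underline R),\tilde\tau)$ with multiplication $\tilde\mu$. Regard $\Gamma(C_*)$ as a simplicial commutative $R$-algebra with the multiplication $\Gamma(C_*)\hat\otimes\Gamma(C_*)\cong\Gamma(C_*\tilde\otimes C_*)\to\Gamma(C_*)$ given by $\Gamma(\tilde\mu)$, and the unit obtained likewise. The shuffle map $N\Gamma(C_*)\otimes N\Gamma(C_*)\to N(\Gamma(C_*)\hat\otimes\Gamma(C_*))=C_*\tilde\otimes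 C_*$ followed by $\tilde\mu$ (with $C_*\cong N\Gamma(C_*)$) induces the structure of a graded commutative $R$-algebra on the homology $H_*=H_*(C_*)$, where $ab=(-1)^{|a||b|}ba$. On $H_*$ there is a system of divided powers, that is, a family of maps $\gamma_i\colon H_n\to H_{in}$ for $i\geqslant 0$ and $n>0$ such that, for all homogeneous elements $a,b$ of positive degree and all $i,j\geqslant 0$: 1. $\gamma_0(a)=1$ and $\gamma_1(a)=a$; 2. $\gamma_i(a)=0$ if $|a|$ is odd and $i>1$; 3. $\gamma_i(\lambda a)=\lambda^i\gamma_i(a)$ for $\lambda\in R$, and also for $\lambda\in H_0$; 4. $\gamma_i(a)\gamma_j(a)=\binom{i+j}{i}\gamma_{i+j}(a)$; 5. $\gamma_i(a+b)=\sum_{k+\ell=i}\gamma_k(a)\gamma_\ell(b)$ if $|a|=|b|$ is even; 6. $\gamma_i(ab)=i!\,\gamma_i(a)\gamma_i(b)=a^i\gamma_i(b)=\gamma_i(a)b^i$; 7. $\gamma_i(\gamma_j(a))=\frac{(ij)!}{i!\,(j!)^i}\gamma_{ij}(a)$ if $j\geqslant 1$. Moreover, this system comes from $\Gamma(C_*)$: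 if $n>0$ is even and $a\in H_n$ is the class of a cycle $c\in C_n\cong N_n\Gamma(C_*)$, then $\gamma_i(a)$ is the class of the cycle $$\sum_{\sigma}\varepsilon(\sigma)\prod_{j=1}^{i}s_{\{0,\dots,ni-1\}\setminus\sigma(\underline j)}(c)\in N_{ni}\Gamma(C_*)\cong C_{ni}.$$ Here $\underline j=\{(j-1)n,\dots,jn-1\}$. The sum runs over the permutations $\sigma$ of $\{0,\dots,ni-1\}$ that are increasing on each block $\underline j$ and satisfy $\sigma(0)<\sigma(n)<\dots<\sigma((i-1)n)$; these represent $\mathrm{Sh}(n,\dots,n)/\Sigma_i$. For a set $S$, $s_S$ is the composite of the degeneracies $s_k$, $k\in S$, smaller indices applied first, and the product is taken in the commutative algebra $\Gamma(C_*)_{ni}$. -/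

import Mathlib

universe u v

noncomputable section

namespace LargeTensor

/-! ### Graded commutative algebras and systems of divided powers -/

/-- A (non-negatively) graded commutative `R`-algebra with underlying graded module `A`.
The product `A p × A q → A (p + q)` is indexed by a proof of `p + q = m`, so that no transport
along equalities of degrees is needed. Commutativity carries the sign `(-1) ^ (p * q)`. -/
structure GradedCommAlgebra (R : Type u) [CommRing R] (A : ℕ → Type v)
    [∀ n, AddCommGroup (A n)] [∀ n, Module R (A n)] where
  /-- the product -/
  mul : ∀ {p q m : ℕ}, p + q = m → (A p →ₗ[R] A q →ₗ[R] A m)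
  /-- the unit -/
  one : A 0
  one_mul : ∀ {p : ℕ} (a : A p), mul (zero_add p) one a = a
  mul_one : ∀ {p : ℕ} (a : A p), mul (add_zero p) a one = a
  mul_assoc : ∀ {p q r s t m : ℕ} (hpq : p + q = s) (hqr : q + r = t) (hs : s + r = m)
    (ht : p + t = m) (a : A p) (b : A q) (c : A r),
    mul hs (mul hpq a b) c = mul ht a (mul hqr b c)
  mul_comm : ∀ {p q m : ℕ} (h : p + q = m) (h' : q + p = m) (a : A p) (b : A q),
    mul h a b = ((-1 : ℤ) ^ (p * q)) • mul h' b a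

namespace GradedCommAlgebra

variable {R : Type u} [CommRing R] {A : ℕ → Type v}
  [∀ n, AddCommGroup (A n)] [∀ n, Module R (A n)]

/-- The power `a ^ i`, an element of degree `i * p` for `a` of degree `p`. -/
def pow (𝒜 : GradedCommAlgebra R A) {p : ℕ} (a : A p) : ∀ i : ℕ, A (i * p)
  | 0 => (zero_mul p).symm ▸ 𝒜.one
  | i + 1 => 𝒜.mul (Nat.succ_mul i p).symm (pow 𝒜 a i) a

end GradedCommAlgebra

/-- A system of divided powers on a graded commutative algebra: operations `γ i : A n → A (i * n)`
for `i ≥ 0` and `n > 0`. Since operations vanish on odd degrees for `i > 1`, additivity is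
required on even degrees. -/
structure GradedDividedPowers {R : Type u} [CommRing R] {A : ℕ → Type v}
    [∀ n, AddCommGroup (A n)] [∀ n, Module R (A n)] (𝒜 : GradedCommAlgebra R A) where
  /-- the divided power operations -/
  γ : ∀ (i : ℕ) {n m : ℕ}, 0 < n → i * n = m → A n → A m
  γ_zero : ∀ {n : ℕ} (hn : 0 < n) (a : A n), γ 0 hn (zero_mul n) a = 𝒜.one
  γ_one : ∀ {n : ℕ} (hn : 0 < n) (a : A n), γ 1 hn (one_mul n) a = a
  γ_odd : ∀ {i n : ℕ} (hn : 0 < n) (a : A n), Odd n → 1 < i → γ i hn rfl a = 0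
  γ_smul : ∀ (i : ℕ) {n : ℕ} (hn : 0 < n) (r : R) (a : A n),
    γ i hn rfl (r • a) = r ^ i • γ i hn rfl a
  /-- homogeneity with respect to scalars from the degree zero part -/
  γ_zero_degree_mul : ∀ (i : ℕ) {n : ℕ} (hn : 0 < n) (l : A 0) (a : A n),
    γ i hn rfl (𝒜.mul (zero_add n) l a) =
      𝒜.mul (by simp) (𝒜.pow l i) (γ i hn rfl a)
  γ_mul_γ : ∀ (i j : ℕ) {n : ℕ} (hn : 0 < n) (a : A n),
    𝒜.mul (add_mul i j n).symm (γ i hn rfl a) (γ j hn rfl a) =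
      (i + j).choose i • γ (i + j) hn rfl a
  γ_add : ∀ (i : ℕ) {n : ℕ} (hn : 0 < n), Even n → ∀ a b : A n,
    γ i hn rfl (a + b) =
      ∑ x ∈ (Finset.HasAntidiagonal.antidiagonal i).attach,
        𝒜.mul (by rw [← add_mul, Finset.HasAntidiagonal.mem_antidiagonal.mp x.2])
          (γ x.1.1 hn rfl a) (γ x.1.2 hn rfl b)
  γ_mul_eq_factorial : ∀ (i : ℕ) {p q : ℕ} (hp : 0 < p) (hq : 0 < q) (a : A p) (b : A q),
    γ i (Nat.add_pos_left hp q) rfl (𝒜.mul rfl a b) =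
      i.factorial • 𝒜.mul (mul_add i p q).symm (γ i hp rfl a) (γ i hq rfl b)
  γ_mul_eq_pow_mul : ∀ (i : ℕ) {p q : ℕ} (hp : 0 < p) (hq : 0 < q) (a : A p) (b : A q),
    γ i (Nat.add_pos_left hp q) rfl (𝒜.mul rfl a b) =
      𝒜.mul (mul_add i p q).symm (𝒜.pow a i) (γ i hq rfl b)
  γ_mul_eq_mul_pow : ∀ (i : ℕ) {p q : ℕ} (hp : 0 < p) (_ : 0 < q) (a : A p) (b : A q),
    γ i (Nat.add_pos_left hp q) rfl (𝒜.mul rfl a b) =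
      𝒜.mul (mul_add i p q).symm (γ i hp rfl a) (𝒜.pow b i)
  γ_γ : ∀ (i : ℕ) {j n : ℕ} (hj : 0 < j) (hn : 0 < n) (a : A n),
    γ i (Nat.mul_pos hj hn) rfl (γ j hn rfl a) =
      ((i * j).factorial / (i.factorial * j.factorial ^ i)) •
        γ (i * j) hn (_root_.mul_assoc i j n) a

open CategoryTheory MonoidalCategory Opposite Simplicial TensorProduct

/-! ### Shuffles and degeneracies -/

/-- For a set `T` of `k` elements of `{0, …, m - 1}`, the monotone surjection `[m] → [k]` with
`t ↦ #{s ∈ T | s < t}`. It is constant exactly on the steps `s < s + 1` with `s ∉ T`. Hence the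
operator that it induces on a simplicial object is the composite of the degeneracies `s_l` with
`l ∈ {0, …, m - 1} \ T`, small indices first. -/
def stepMap {m k : ℕ} (T : Finset (Fin m)) (hT : T.card = k) : ⦋m⦌ ⟶ ⦋k⦌ :=
  SimplexCategory.mkHom
    { toFun := fun t => ⟨(T.filter fun s => s.val < t.val).card,
        Nat.lt_succ_of_le ((Finset.card_filter_le _ _).trans hT.le)⟩
      monotone' := fun _ _ h => Finset.card_le_card fun s hs => by
        simp only [Finset.mem_filter] at hs ⊢
        exact ⟨hs.1, hs.2.trans_le h⟩ }

/-- The values on the first block `{0, …, p - 1}` of a permutation of `{0, …, p + q - 1}`. -/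
def firstBlock {p q : ℕ} (σ : Equiv.Perm (Fin (p + q))) : Finset (Fin (p + q)) :=
  Finset.univ.map ((Fin.castAddEmb q).trans σ.toEmbedding)

/-- The values on the second block `{p, …, p + q - 1}` of a permutation of
`{0, …, p + q - 1}`. -/
def secondBlock {p q : ℕ} (σ : Equiv.Perm (Fin (p + q))) : Finset (Fin (p + q)) :=
  Finset.univ.map ((Fin.natAddEmb p).trans σ.toEmbedding)

lemma card_firstBlock {p q : ℕ} (σ : Equiv.Perm (Fin (p + q))) : (firstBlock σ).card = p := by
  simp [firstBlock]

lemma card_secondBlock {p q : ℕ} (σ : Equiv.Perm (Fin (p + q))) : (secondBlock σ).card = q := by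
  simp [secondBlock]

open Classical in
/-- The set `Sh(p, q)` of shuffles: permutations that increase on both blocks. -/
def shuffles (p q : ℕ) : Finset (Equiv.Perm (Fin (p + q))) :=
  Finset.univ.filter fun σ =>
    StrictMono (fun t : Fin p => σ (Fin.castAdd q t)) ∧
      StrictMono (fun t : Fin q => σ (Fin.natAdd p t))

/-- The values of a permutation of `{0, …, i * n - 1}` on its `j`-th block
`{n * j, …, n * j + n - 1}`, where `0 ≤ j < i`. -/
def block {i n : ℕ} (σ : Equiv.Perm (Fin (i * n))) (j : Fin i) : Finset (Fin (i * n)) :=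
  Finset.univ.map ⟨fun t : Fin n => σ (finProdFinEquiv (j, t)), fun t t' h => by simpa using h⟩

lemma card_block {i n : ℕ} (σ : Equiv.Perm (Fin (i * n))) (j : Fin i) :
    (block σ j).card = n := by
  simp [block]

open Classical in
/-- A system of representatives of `Sh(n, …, n) / Σ_i`: the permutations of `{0, …, i * n - 1}`
that increase on each of the `i` blocks of size `n` and whose values on the first elements of
the blocks increase, too. -/
def blockShuffles (i n : ℕ) (hn : 0 < n) : Finset (Equiv.Perm (Fin (i * n))) :=
  Finset.univ.filter fun σ =>
    (∀ j : Fin i, StrictMono fun t : Fin n => σ (finProdFinEquiv (j, t))) ∧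
      StrictMono fun j : Fin i => σ (finProdFinEquiv (j, ⟨0, hn⟩))

/-! ### The large tensor product of chain complexes -/

variable (R : Type u) [CommRing R]

/-- Simplicial `R`-modules, with the degreewise tensor product. -/
abbrev SMod := SimplexCategoryᵒᵖ ⥤ ModuleCat.{u} R

/-- The Dold-Kan equivalence between simplicial `R`-modules and non-negatively graded chain
complexes of `R`-modules. Its functor is the normalization `N`, its inverse is `Γ`. -/
abbrev doldKan : SMod R ≌ ChainComplex (ModuleCat.{u} R) ℕ :=
  Abelian.DoldKan.equivalence (A := ModuleCat.{u} R)

/-- Non-negatively graded chain complexes of `R`-modules with the large tensor product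
`N (Γ C ⊗ Γ D)`, with unit `N` of the constant simplicial module `R`, and with the twist that is
`N` of the twist of `Γ C ⊗ Γ D`. -/
abbrev LargeCh := Monoidal.Transported (doldKan R)

variable {R}

/-- The chain complex that underlies an object. -/
abbrev LargeCh.complex (C : LargeCh R) : ChainComplex (ModuleCat.{u} R) ℕ := C

/-- The chain map that underlies a morphism. -/
abbrev LargeCh.chainMap {C D : LargeCh R} (f : C ⟶ D) : C.complex ⟶ D.complex := f

/-- The normalized chain complex `N A`. -/
abbrev normalized (A : SMod R) : ChainComplex (ModuleCat.{u} R) ℕ := (doldKan R).functor.obj A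

/-- The simplicial module `Γ C`. -/
abbrev gamma (C : LargeCh R) : SMod R := (doldKan R).inverse.obj C

/-- The inclusion of `N A` into `A` in degree `n`. -/
def incl (A : SMod R) (n : ℕ) : (normalized A).X n →ₗ[R] A.obj (op ⦋n⦌) :=
  ((AlgebraicTopology.inclusionOfMooreComplexMap (A := ModuleCat.{u} R) A).f n).hom

/-- The canonical isomorphism from `C` to `N (Γ C)` in degree `n`. -/
def toNormalized (C : LargeCh R) (n : ℕ) : C.complex.X n →ₗ[R] (normalized (gamma C)).X n :=
  (((doldKan R).counitIso.inv.app C).f n).hom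

/-- `IsShuffle x y s` says that `s` is the image of `x ⊗ y` under the shuffle map
`N A ⊗ N B → N (A ⊗ B)`, that is, the sum over `Sh(p, q)` of the signed tensors of
degeneracies of `x` and `y`. -/
def IsShuffle {A B : SMod R} {p q : ℕ} (x : (normalized A).X p) (y : (normalized B).X q)
    (s : (normalized (A ⊗ B)).X (p + q)) : Prop :=
  (incl (A ⊗ B) (p + q) s : (A.obj (op ⦋p + q⦌) ⊗[R] B.obj (op ⦋p + q⦌) : Type u)) =
    ∑ σ ∈ shuffles p q, ((Equiv.Perm.sign σ : ℤˣ) : ℤ) •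
      ((A.map (stepMap (firstBlock σ) (card_firstBlock σ)).op).hom (incl A p x) ⊗ₜ[R]
        (B.map (stepMap (secondBlock σ) (card_secondBlock σ)).op).hom (incl B q y))

/-- The multiplication `Γ C ⊗ Γ C → Γ C` that a monoid `C` for the large tensor product
induces. -/
def gammaMul (C : LargeCh R) [MonObj C] : gamma C ⊗ gamma C ⟶ gamma C :=
  (doldKan R).unitIso.hom.app (gamma C ⊗ gamma C) ≫ (doldKan R).inverse.map (LargeCh.chainMap (MonObj.mul (X := C)))

/-- The unit map of `Γ C`, from the constant simplicial module `R`. -/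
def gammaOne (C : LargeCh R) [MonObj C] : 𝟙_ (SMod R) ⟶ gamma C :=
  (doldKan R).unitIso.hom.app (𝟙_ (SMod R)) ≫ (doldKan R).inverse.map (LargeCh.chainMap (MonObj.one (X := C)))

/-- The product of a list of elements of the commutative algebra `(Γ C)_m`. -/
def gammaProd (C : LargeCh R) [MonObj C] (m : ℕ) (l : List ((gamma C).obj (op ⦋m⦌))) :
    (gamma C).obj (op ⦋m⦌) :=
  l.foldr (fun x y => ((gammaMul C).app (op ⦋m⦌)).hom (x ⊗ₜ[R] y))
    (((gammaOne C).app (op ⦋m⦌)).hom (1 : R))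

/-- The sum, over representatives `σ` of `Sh(n, …, n) / Σ_i`, of the signed products in
`(Γ C)_{i n}` of the `i` degeneracies of `x ∈ (Γ C)_n` that belong to the blocks of `σ`. -/
def dividedPowerSum (C : LargeCh R) [MonObj C] (i : ℕ) {n : ℕ} (hn : 0 < n)
    (x : (gamma C).obj (op ⦋n⦌)) : (gamma C).obj (op ⦋i * n⦌) :=
  ∑ σ ∈ blockShuffles i n hn, ((Equiv.Perm.sign σ : ℤˣ) : ℤ) •
    gammaProd C (i * n) (List.ofFn fun j : Fin i =>
      ((gamma C).map (stepMap (block σ j) (card_block σ j)).op).hom x)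

/-! ### Homology -/

/-- The homology of `C` in degree `n`. -/
abbrev H (C : LargeCh R) (n : ℕ) : ModuleCat.{u} R := C.complex.homology n

/-- The chain `x` is a cycle and `u` is its homology class. -/
def Represents (C : LargeCh R) {n : ℕ} (x : C.complex.X n) (u : H C n) : Prop :=
  ∃ z : C.complex.cycles n,
    (C.complex.iCycles n).hom z = x ∧ (C.complex.homologyπ n).hom z = u

/-- The graded commutative algebra structure on the homology of `C` is the one induced by the
monoid `C`: the unit is the class of the image of `1`, and the product of the classes of cycles
`x` and `y` is the class of the image of their shuffle product under the multiplication
`N (Γ C ⊗ Γ C) → C`. As every homology class has a representing cycle, this determines the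
structure. -/
structure IsInducedAlgebra (C : LargeCh R) [MonObj C]
    (𝒜 : GradedCommAlgebra R (fun n => H C n)) : Prop where
  one : ∃ e : (normalized (𝟙_ (SMod R))).X 0,
    incl (𝟙_ (SMod R)) 0 e = (1 : R) ∧
      Represents C (((LargeCh.chainMap (MonObj.one (X := C))).f 0).hom e) 𝒜.one
  mul : ∀ {p q : ℕ} (x : C.complex.X p) (y : C.complex.X q) (a : H C p) (b : H C q),
    Represents C x a → Represents C y b →
      ∃ s : (normalized (gamma C ⊗ gamma C)).X (p + q),
        IsShuffle (toNormalized C p x) (toNormalized C q y) s ∧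
          Represents C (((LargeCh.chainMap (MonObj.mul (X := C))).f (p + q)).hom s) (𝒜.mul rfl a b)

/-- The system of divided powers is the one that comes from the simplicial commutative algebra
`Γ C`: in positive even degrees, `γ_i` of the class of a cycle `x` is the class of the cycle that
is given by the shuffle sum in `Γ C`. (In odd degrees, `γ_i` is zero for `i > 1`.) -/
def IsInducedDividedPowers (C : LargeCh R) [MonObj C]
    {𝒜 : GradedCommAlgebra R (fun n => H C n)} (D : GradedDividedPowers 𝒜) : Prop :=
  ∀ (i : ℕ) {n : ℕ} (hn : 0 < n), Even n → ∀ (x : C.complex.X n) (a : H C n),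
    Represents C x a →
      ∃ w : C.complex.X (i * n),
        incl (gamma C) (i * n) (toNormalized C (i * n) w) =
          dividedPowerSum C i hn (incl (gamma C) n (toNormalized C n x)) ∧
        Represents C w (D.γ i hn rfl a)

end LargeTensor

end

universe w

noncomputable section

namespace LargeTensor

/-! ### The Grassmann ring -/

/-! The combinatorics of shuffles is encoded in exterior algebras. For a simplicial commutative
algebra `A`, let the basis vectors be the `m` steps of `[m]` and let the coefficients lie in `A m`.
An element `x` of `A p` gives the element `phi m x` of degree `p` whose coefficient at a `p`-set `T`
is the degeneracy of `x` belonging to `T`; its coefficient at the full set for `m = p` is `x`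
itself. The shuffle product becomes the exterior product (`phi_sh`), so associativity and graded
commutativity on chains are inherited from the exterior algebra.

In that algebra, an element `z` of positive even degree is a sum of central monomials of square
zero. Hence `z ^ k` is `k!` times the `k`-th elementary symmetric function of these monomials, and
this function is the divided power `dp k z`. The divided power identities are universal:
coefficients are lifted to a polynomial ring over the integers, where `k!` can be cancelled, and
there they reduce to identities between powers. The operations on chains are the top coefficients of
the `dp i (phi m x)`, and `phi_dpow` transfers the identities.

Cycles are handled by contractions. Vertex `j` of `[m]` defines the linear form "step before `j`
minus step after `j`". If an operator omits `j` and `x` is a cycle, contraction with this form kills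
the image of `phi m x`. Contraction is an antiderivation with `contr l (dp (k + 1) z) = contr l z *
dp k z` in even degrees, so products and divided powers are killed too; as the form has a
coefficient `±1`, their top coefficients vanish (`apply_univ_eq_zero`). The form of vertex `0`
likewise yields `d (y x) = (d y) x` for a cycle `x`. A divided power of positive index of a boundary
`d y` is a boundary (`exists_d_eq_dpow`), and additivity then makes divided powers well defined on
homology.

Two comparisons remain. The signs of the exterior algebra are the signs of permutations, by the
alternating property of ordered products; `p`-sets correspond to shuffles, and partitions into
`n`-sets to block shuffles (`sh_eq_sum`, `dpow_eq_sum`). Finally, `Γ` is monoidal and braided for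
the transported structure, so `Γ C` is a simplicial commutative algebra whose normalized chains are
those of `C`. -/

/-- The exterior algebra of the free `A`-module on a linearly ordered set `ι`: an element is given
by its coefficients at the ordered monomials, which are indexed by the finite subsets of `ι`. -/
def Grassmann (ι A : Type*) := Finset ι → A

namespace Grassmann

set_option linter.unusedSectionVars false

/-! ### Signs of merging finite sets -/

section Sign

variable {ι κ : Type*} [LinearOrder ι] [LinearOrder κ]

/-- The sign of the shuffle that merges two finite sets. -/
def eps (T U : Finset ι) : ℤ := ∏ t ∈ T, ∏ u ∈ U, if u < t then -1 else 1

@[simp] lemma eps_empty_left (U : Finset ι) : eps ∅ U = 1 := by simp [eps]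

@[simp] lemma eps_empty_right (T : Finset ι) : eps T ∅ = 1 := by simp [eps]

lemma eps_union_left {T U : Finset ι} (h : Disjoint T U) (V : Finset ι) :
    eps (T ∪ U) V = eps T V * eps U V := by
  rw [eps, Finset.prod_union h, eps, eps]

lemma eps_union_right (T : Finset ι) {U V : Finset ι} (h : Disjoint U V) :
    eps T (U ∪ V) = eps T U * eps T V := by
  simp only [eps, Finset.prod_union h, Finset.prod_mul_distrib]

lemma eps_insert_left {s : ι} {T : Finset ι} (h : s ∉ T) (V : Finset ι) :
    eps (insert s T) V = eps {s} V * eps T V := by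
  rw [Finset.insert_eq, eps_union_left (by simpa using h)]

lemma eps_insert_right (V : Finset ι) {s : ι} {T : Finset ι} (h : s ∉ T) :
    eps V (insert s T) = eps V {s} * eps V T := by
  rw [Finset.insert_eq, eps_union_right _ (by simpa using h)]

/-- Each of the pairs in `T × U` is an inversion for exactly one of the two orders. -/
lemma eps_mul_swap {T U : Finset ι} (h : Disjoint T U) :
    eps T U * eps U T = (-1) ^ (T.card * U.card) := by
  rw [eps, eps, Finset.prod_comm (s := U), ← Finset.prod_mul_distrib]
  have : ∀ t ∈ T, ((∏ u ∈ U, if u < t then (-1 : ℤ) else 1) * ∏ u ∈ U, if t < u then -1 else 1) =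
      (-1) ^ U.card := by
    intro t ht
    rw [← Finset.prod_mul_distrib, ← Finset.prod_const]
    refine Finset.prod_congr rfl fun u hu => ?_
    have hne : t ≠ u := fun e => Finset.disjoint_left.mp h ht (e ▸ hu)
    rcases lt_or_gt_of_ne hne with h | h <;> simp [h, h.le, not_lt_of_ge]
  rw [Finset.prod_congr rfl this, Finset.prod_const, ← pow_mul, mul_comm U.card]

lemma eps_mul_self (T U : Finset ι) : eps T U * eps T U = 1 := by
  simp only [eps, ← Finset.prod_mul_distrib]
  refine Finset.prod_eq_one fun t _ => Finset.prod_eq_one fun u _ => ?_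
  split_ifs <;> simp

lemma eps_map (f : κ ↪o ι) (T U : Finset κ) :
    eps (T.map f.toEmbedding) (U.map f.toEmbedding) = eps T U := by
  simp [eps]

end Sign

/-! ### The exterior product and its functoriality -/

section Ring

variable {ι κ A B : Type*} [LinearOrder ι] [LinearOrder κ] [CommRing A] [CommRing B]

instance : AddCommGroup (Grassmann ι A) := inferInstanceAs (AddCommGroup (Finset ι → A))

instance {S : Type*} [Semiring S] [Module S A] : Module S (Grassmann ι A) :=
  inferInstanceAs (Module S (Finset ι → A))

@[ext] lemma ext {z w : Grassmann ι A} (h : ∀ T, z T = w T) : z = w := funext h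

@[simp] lemma add_apply (z w : Grassmann ι A) (T : Finset ι) : (z + w) T = z T + w T := rfl
@[simp] lemma neg_apply (z : Grassmann ι A) (T : Finset ι) : (-z) T = -z T := rfl
@[simp] lemma zero_apply (T : Finset ι) : (0 : Grassmann ι A) T = 0 := rfl
@[simp] lemma smul_apply {S : Type*} [Semiring S] [Module S A] (a : S) (z : Grassmann ι A)
    (T : Finset ι) : (a • z) T = a • z T := rfl

lemma zsmul_apply (a : ℤ) (z : Grassmann ι A) (T : Finset ι) : (a • z) T = a • z T := rfl
lemma nsmul_apply (a : ℕ) (z : Grassmann ι A) (T : Finset ι) : (a • z) T = a • z T := rfl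

/-- The multiple `a e_T` of a monomial. -/
def mono (T : Finset ι) (a : A) : Grassmann ι A := fun U => if U = T then a else 0

lemma mono_apply (T U : Finset ι) (a : A) : mono T a U = if U = T then a else 0 := rfl

instance : One (Grassmann ι A) := ⟨mono ∅ 1⟩

lemma one_apply (T : Finset ι) : (1 : Grassmann ι A) T = if T = ∅ then 1 else 0 := rfl

instance : Mul (Grassmann ι A) :=
  ⟨fun z w W => ∑ T ∈ W.powerset, (eps T (W \ T) : A) * (z T * w (W \ T))⟩

lemma mul_apply (z w : Grassmann ι A) (W : Finset ι) :
    (z * w) W = ∑ T ∈ W.powerset, (eps T (W \ T) : A) * (z T * w (W \ T)) := rfl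

/-- Both sides sum over the ordered decompositions of `W` into three disjoint sets; both signs are
the product of the three pairwise signs. -/
lemma mul_assoc' (z w v : Grassmann ι A) : z * w * v = z * (w * v) := by
  ext W
  simp only [mul_apply, Finset.sum_mul, Finset.mul_sum]
  rw [Finset.sum_sigma', Finset.sum_sigma']
  refine Finset.sum_bij' (fun x _ => ⟨x.2, x.1 \ x.2⟩) (fun x _ => ⟨x.1 ∪ x.2, x.1⟩) ?_ ?_ ?_ ?_ ?_
  · rintro ⟨T, U⟩ h
    simp only [Finset.mem_sigma, Finset.mem_powerset] at h ⊢
    exact ⟨h.2.trans h.1, Finset.sdiff_subset_sdiff h.1 le_rfl⟩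
  · rintro ⟨U, V⟩ h
    simp only [Finset.mem_sigma, Finset.mem_powerset] at h ⊢
    exact ⟨Finset.union_subset h.1 (h.2.trans Finset.sdiff_subset), Finset.subset_union_left⟩
  · rintro ⟨T, U⟩ h
    simp only [Finset.mem_sigma, Finset.mem_powerset] at h
    simp [Finset.union_sdiff_of_subset h.2]
  · rintro ⟨U, V⟩ h
    simp only [Finset.mem_sigma, Finset.mem_powerset] at h
    have : Disjoint U V := Finset.disjoint_of_subset_right h.2 Finset.disjoint_sdiff
    simp [Finset.union_sdiff_cancel_left this]
  · rintro ⟨T, U⟩ h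
    simp only [Finset.mem_sigma, Finset.mem_powerset] at h ⊢
    have h1 : (W \ U) \ (T \ U) = W \ T := by
      ext x
      have := @h.2 x
      simp only [Finset.mem_sdiff]
      tauto
    have h2 : eps T (W \ T) = eps U (W \ T) * eps (T \ U) (W \ T) := by
      rw [← eps_union_left Finset.disjoint_sdiff, Finset.union_sdiff_of_subset h.2]
    have h3 : eps U (W \ U) = eps U (T \ U) * eps U (W \ T) := by
      rw [← eps_union_right]
      · congr 1
        ext x
        have := @h.2 x
        have := @h.1 x
        simp only [Finset.mem_sdiff, Finset.mem_union]
        tauto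
      · exact Finset.disjoint_of_subset_left Finset.sdiff_subset Finset.disjoint_sdiff
    rw [h1, h2, h3]
    push_cast
    ring

instance : Ring (Grassmann ι A) :=
  { (inferInstance : AddCommGroup (Grassmann ι A)) with
    mul := (· * ·)
    one := 1
    left_distrib := fun z w v => by
      ext W
      simp only [mul_apply, add_apply, mul_add, Finset.sum_add_distrib]
    right_distrib := fun z w v => by
      ext W
      simp only [mul_apply, add_apply, mul_add, add_mul, Finset.sum_add_distrib]
    zero_mul := fun z => by ext W; simp [mul_apply]
    mul_zero := fun z => by ext W; simp [mul_apply]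
    mul_assoc := mul_assoc'
    one_mul := fun z => by
      ext W
      rw [mul_apply, Finset.sum_eq_single ∅] <;> simp +contextual [one_apply]
    mul_one := fun z => by
      ext W
      rw [mul_apply, Finset.sum_eq_single W]
      · simp [one_apply]
      · intro T hT hne
        have : W \ T ≠ ∅ := fun e => hne <| (Finset.mem_powerset.mp hT).antisymm
          (Finset.sdiff_eq_empty_iff_subset.mp e)
        simp [one_apply, this]
      · simp }

instance : Algebra A (Grassmann ι A) :=
  Algebra.ofModule
    (fun a z w => by
      ext W
      simp only [mul_apply, smul_apply, smul_eq_mul, Finset.mul_sum]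
      exact Finset.sum_congr rfl fun _ _ => by ring)
    (fun a z w => by
      ext W
      simp only [mul_apply, smul_apply, smul_eq_mul, Finset.mul_sum]
      exact Finset.sum_congr rfl fun _ _ => by ring)

@[simp] lemma sum_apply {α : Type*} (s : Finset α) (f : α → Grassmann ι A) (T : Finset ι) :
    (∑ i ∈ s, f i) T = ∑ i ∈ s, f i T :=
  Finset.sum_apply T s f

/-- Apply a ring homomorphism to the coefficients. -/
def map (φ : A →+* B) : Grassmann ι A →+* Grassmann ι B where
  toFun z T := φ (z T)
  map_one' := by ext T; simp only [one_apply]; split_ifs <;> simp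
  map_mul' z w := by
    ext W
    exact (map_sum φ _ _).trans (Finset.sum_congr rfl fun T _ => by simp only [map_mul, map_intCast])
  map_zero' := by ext T; simp
  map_add' z w := by ext T; exact map_add φ _ _

@[simp] lemma map_apply (φ : A →+* B) (z : Grassmann ι A) (T : Finset ι) : map φ z T = φ (z T) :=
  rfl

/-- Restrict to the subsets in the image of an order embedding. -/
def restrict (f : κ ↪o ι) : Grassmann ι A →+* Grassmann κ A where
  toFun z T := z (T.map f.toEmbedding)
  map_one' := by ext T; simp [one_apply]
  map_mul' z w := by
    ext W
    simp only [mul_apply]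
    refine (Finset.sum_bij (fun T _ => T.map f.toEmbedding) ?_ ?_ ?_ ?_).symm
    · intro T hT
      simpa using hT
    · intro T _ U _ h
      simpa using h
    · intro U hU
      obtain ⟨T, hT, rfl⟩ := Finset.subset_map_iff.mp (Finset.mem_powerset.mp hU)
      exact ⟨T, by simpa using hT, rfl⟩
    · intro T _
      rw [← Finset.map_sdiff, eps_map]
  map_zero' := rfl
  map_add' _ _ := rfl

@[simp] lemma restrict_apply (f : κ ↪o ι) (z : Grassmann ι A) (T : Finset κ) :
    restrict f z T = z (T.map f.toEmbedding) := rfl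

/-- Passing to the complement in `W` exchanges the factors. The hypothesis concerns only the
supports, so that the lemma covers both a pair of homogeneous elements and an even element against
an arbitrary one. -/
lemma mul_eq_zsmul_mul {z w : Grassmann ι A} (s : ℤ)
    (h : ∀ T U, z T ≠ 0 → w U ≠ 0 → (-1) ^ (T.card * U.card) = s) : z * w = s • (w * z) := by
  ext W
  rw [zsmul_apply, mul_apply, mul_apply, Finset.smul_sum]
  refine Finset.sum_bij' (fun T _ => W \ T) (fun T _ => W \ T) ?_ ?_ ?_ ?_ ?_
  · simp
  · simp
  · intro T hT
    simpa using hT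
  · intro T hT
    simpa using hT
  · intro T hT
    have hT' : T ⊆ W := by simpa using hT
    rw [Finset.sdiff_sdiff_eq_self hT']
    by_cases hz : z T = 0
    · simp [hz]
    by_cases hw : w (W \ T) = 0
    · simp [hw]
    have h1 := h T (W \ T) hz hw
    have h2 : eps T (W \ T) = s * eps (W \ T) T := by
      rw [← h1, ← eps_mul_swap Finset.disjoint_sdiff, mul_assoc, eps_mul_self, mul_one]
    rw [h2, zsmul_eq_mul]
    push_cast
    ring

lemma mono_mul_self {T : Finset ι} (hT : T.Nonempty) (a b : A) : mono T a * mono T b = 0 := by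
  ext W
  rw [mul_apply]
  refine Finset.sum_eq_zero fun U hU => ?_
  simp only [mono_apply]
  split_ifs with h1 h2
  · obtain ⟨x, hx⟩ := hT
    have h3 := hx
    rw [← h2, h1] at h3
    simp [hx] at h3
  · simp
  · simp
  · simp

/-! ### Contractions -/

/-- The contraction with a basis vector. -/
def contr₁ (s : ι) (z : Grassmann ι A) : Grassmann ι A := fun T =>
  if s ∈ T then 0 else (eps {s} T : A) * z (insert s T)

/-- The grading involution. -/
def bar (z : Grassmann ι A) : Grassmann ι A := fun T => ((-1) ^ T.card : A) * z T

/-- The graded Leibniz rule. At sets that contain `s` the two terms on the right cancel; at the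
others, the subsets of `insert s T` are split according to whether they contain `s`. -/
lemma contr₁_mul (s : ι) (z w : Grassmann ι A) :
    contr₁ s (z * w) = contr₁ s z * w + bar z * contr₁ s w := by
  ext T
  by_cases hs : s ∈ T
  · obtain ⟨T, hs', rfl⟩ : ∃ T', s ∉ T' ∧ T = insert s T' :=
      ⟨T.erase s, by simp, (Finset.insert_erase hs).symm⟩
    clear hs
    rename' hs' => hs
    simp only [contr₁, add_apply, mul_apply, Finset.mem_insert_self, if_true]
    rw [Finset.sum_powerset_insert hs, Finset.sum_powerset_insert hs]
    symm
    have e1 : ∀ U ∈ T.powerset, s ∉ U ∧ insert s T \ U = insert s (T \ U) ∧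
        insert s T \ insert s U = T \ U ∧ s ∉ T \ U := by
      intro U hU
      have hU' : U ⊆ T := by simpa using hU
      have : s ∉ U := fun h => hs (hU' h)
      refine ⟨this, Finset.insert_sdiff_of_notMem _ this, ?_, fun h => hs (Finset.sdiff_subset h)⟩
      rw [Finset.insert_sdiff_insert, Finset.sdiff_insert_of_notMem hs]
    rw [Finset.sum_eq_zero (s := T.powerset) (f := fun t => (eps (insert s t) (insert s T \ insert s t) : A) * _), add_zero,
      Finset.sum_eq_zero (s := T.powerset) (f := fun t => (eps t (insert s T \ t) : A) * (bar z t * _)), zero_add,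
      ← Finset.sum_add_distrib]
    · refine Finset.sum_eq_zero fun U hU => ?_
      obtain ⟨h1, h2, h3, h4⟩ := e1 U hU
      have h5 := eps_mul_swap (T := U) (U := {s}) (by simpa using h1)
      have h6 := eps_mul_self {s} (T \ U)
      simp only [h1, h2, h3, h4, if_false, bar, eps_insert_left h1, eps_insert_right _ h4,
        Finset.card_insert_of_notMem h1]
      simp only [Finset.card_singleton, mul_one] at h5
      have h5' : (eps U {s} : A) * eps {s} U = (-1) ^ U.card := by exact_mod_cast congrArg (Int.cast : ℤ → A) h5
      have h6' : (eps {s} (T \ U) : A) * eps {s} (T \ U) = 1 := by exact_mod_cast congrArg (Int.cast : ℤ → A) h6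
      push_cast
      linear_combination ((eps U (T \ U) : A) * z (insert s U) * w (insert s (T \ U))) * h5' -
        ((eps U (T \ U) : A) * z (insert s U) * w (insert s (T \ U))) * (-1) ^ U.card * h6'
    · intro U hU
      obtain ⟨h1, h2, h3, h4⟩ := e1 U hU
      simp [h2]
    · intro U hU
      simp
  · simp only [contr₁, add_apply, hs, if_false, mul_apply]
    rw [Finset.sum_powerset_insert hs, mul_add, add_comm]
    congr 1
    · rw [Finset.mul_sum]
      refine Finset.sum_congr rfl fun U hU => ?_
      have hU' : U ⊆ T := by simpa using hU
      have h1 : s ∉ U := fun h => hs (hU' h)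
      have h3 : insert s T \ insert s U = T \ U := by
        rw [Finset.insert_sdiff_insert, Finset.sdiff_insert_of_notMem hs]
      have h7 : eps {s} T = eps {s} U * eps {s} (T \ U) := by
        rw [← eps_union_right _ Finset.disjoint_sdiff, Finset.union_sdiff_of_subset hU']
      have h6 := eps_mul_self {s} (T \ U)
      have h6' : (eps {s} (T \ U) : A) * eps {s} (T \ U) = 1 := by exact_mod_cast congrArg (Int.cast : ℤ → A) h6
      simp only [h1, h3, if_false, eps_insert_left h1, h7]
      push_cast
      linear_combination ((eps {s} U : A) * eps U (T \ U) * z (insert s U) * w (T \ U)) * h6'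
    · rw [Finset.mul_sum]
      refine Finset.sum_congr rfl fun U hU => ?_
      have hU' : U ⊆ T := by simpa using hU
      have h1 : s ∉ U := fun h => hs (hU' h)
      have h2 : insert s T \ U = insert s (T \ U) := Finset.insert_sdiff_of_notMem _ h1
      have h4 : s ∉ T \ U := fun h => hs (Finset.sdiff_subset h)
      have h7 : eps {s} T = eps {s} U * eps {s} (T \ U) := by
        rw [← eps_union_right _ Finset.disjoint_sdiff, Finset.union_sdiff_of_subset hU']
      have h5 := eps_mul_swap (T := U) (U := {s}) (by simpa using h1)
      simp only [Finset.card_singleton, mul_one] at h5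
      have h5' : (eps U {s} : A) * eps {s} U = (-1) ^ U.card := by exact_mod_cast congrArg (Int.cast : ℤ → A) h5
      simp only [h2, h4, if_false, eps_insert_right _ h4, h7, bar]
      push_cast
      linear_combination ((eps {s} (T \ U) : A) * eps U (T \ U) * z U * w (insert s (T \ U))) * h5'

variable [Fintype ι]

/-- The contraction with an integral linear form. -/
def contr (l : ι → ℤ) : Grassmann ι A →+ Grassmann ι A where
  toFun z := ∑ s, l s • contr₁ s z
  map_zero' := Finset.sum_eq_zero fun s _ => by
    have h : contr₁ s (0 : Grassmann ι A) = 0 := by ext T; simp [contr₁]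
    rw [h, smul_zero]
  map_add' z w := by
    rw [← Finset.sum_add_distrib]
    refine Finset.sum_congr rfl fun s _ => ?_
    rw [← smul_add]
    congr 1
    ext T
    simp only [contr₁, add_apply]
    split_ifs <;> ring

lemma contr_apply (l : ι → ℤ) (z : Grassmann ι A) : contr l z = ∑ s, l s • contr₁ s z := rfl

lemma contr_mul (l : ι → ℤ) (z w : Grassmann ι A) :
    contr l (z * w) = contr l z * w + bar z * contr l w := by
  simp only [contr_apply, contr₁_mul, smul_add, Finset.sum_add_distrib, Finset.sum_mul,
    Finset.mul_sum, smul_mul_assoc, mul_smul_comm]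

lemma contr_map (l : ι → ℤ) (φ : A →+* B) (z : Grassmann ι A) :
    contr l (map φ z) = map φ (contr l z) := by
  simp only [contr_apply, map_sum, map_zsmul]
  refine Finset.sum_congr rfl fun s _ => ?_
  congr 1
  ext T
  simp only [contr₁, map_apply]
  split_ifs <;> simp

/-- At the complement of `s` only the step `s` can be inserted, so this coefficient of the
contraction is `± l s` times the top coefficient of `z`. -/
lemma apply_univ_eq_zero {l : ι → ℤ} {z : Grassmann ι A} (h : contr l z = 0) {s : ι}
    (hs : l s * l s = 1) : z Finset.univ = 0 := by
  have h1 := congrFun h (Finset.univ.erase s)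
  rw [contr_apply, sum_apply, Finset.sum_eq_single s, zsmul_apply, contr₁, if_neg (by simp),
    Finset.insert_erase (Finset.mem_univ s)] at h1
  · have h2 : l s • eps {s} (Finset.univ.erase s) • (l s • ((eps {s} (Finset.univ.erase s) : A) * z Finset.univ)) = 0 := by
      rw [h1]; simp
    have h3 := eps_mul_self {s} (Finset.univ.erase s)
    have h4 : (l s : A) * l s = 1 := by exact_mod_cast congrArg (Int.cast : ℤ → A) hs
    have h5 : (eps {s} (Finset.univ.erase s) : A) * eps {s} (Finset.univ.erase s) = 1 := by
      exact_mod_cast congrArg (Int.cast : ℤ → A) h3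
    simp only [zsmul_eq_mul] at h2
    linear_combination h2 - z Finset.univ * h4 - (l s : A) * l s * z Finset.univ * h5
  · intro t _ ht
    simp [contr₁, ht, zsmul_apply]
  · simp

end Ring

/-! ### Homogeneous elements -/

section Hom

variable {ι κ A B : Type*} [LinearOrder ι] [LinearOrder κ] [CommRing A] [CommRing B]

/-- An element is homogeneous of degree `p` if it is supported on the subsets with `p` elements. -/
def IsHom (p : ℕ) (z : Grassmann ι A) : Prop := ∀ T, z T ≠ 0 → T.card = p

variable {p q : ℕ} {z w : Grassmann ι A}

lemma IsHom.add (hz : IsHom p z) (hw : IsHom p w) : IsHom p (z + w) := fun T hT => by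
  by_cases h : z T = 0
  · exact hw T fun h' => hT (by simp [h, h'])
  · exact hz T h

lemma isHom_one : IsHom 0 (1 : Grassmann ι A) := fun T hT => by
  by_contra h
  exact hT (by rw [one_apply, if_neg (by simpa using h)])

lemma IsHom.smul (hz : IsHom p z) (a : A) : IsHom p (a • z) := fun T hT =>
  hz T fun h => hT (by simp [h])

lemma IsHom.mul (hz : IsHom p z) (hw : IsHom q w) : IsHom (p + q) (z * w) := fun T hT => by
  rw [mul_apply] at hT
  obtain ⟨U, hU, h⟩ := Finset.exists_ne_zero_of_sum_ne_zero hT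
  have h1 := hz U fun h' => h (by simp [h'])
  have h2 := hw (T \ U) fun h' => h (by simp [h'])
  rw [← Finset.card_sdiff_add_card_eq_card (Finset.mem_powerset.mp hU), h1, h2, add_comm]

lemma IsHom.pow (hz : IsHom p z) (k : ℕ) : IsHom (k * p) (z ^ k) := by
  induction k with
  | zero => simpa using isHom_one
  | succ k ih => rw [pow_succ, Nat.succ_mul]; exact ih.mul hz

lemma IsHom.mul_comm (hz : IsHom p z) (hw : IsHom q w) : z * w = ((-1 : ℤ) ^ (p * q)) • (w * z) :=
  mul_eq_zsmul_mul _ fun T U hT hU => by rw [hz T hT, hw U hU]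

lemma IsHom.commute (hz : IsHom p z) (hp : Even p) (w : Grassmann ι A) : Commute z w := by
  have := mul_eq_zsmul_mul (z := z) (w := w) 1 fun T U hT _ => by
    rw [hz T hT, (hp.mul_right _).neg_one_pow]
  rwa [one_smul] at this

lemma IsHom.bar (hz : IsHom p z) (hp : Even p) : bar z = z := by
  ext T
  by_cases h : z T = 0
  · simp [Grassmann.bar, h]
  · simp [Grassmann.bar, hz T h, hp.neg_one_pow]

lemma IsHom.restrict (hz : IsHom p z) (f : κ ↪o ι) : IsHom p (restrict f z) := fun T hT => by
  simpa using hz _ hT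

lemma IsHom.map (hz : IsHom p z) (φ : A →+* B) : IsHom p (map φ z) := fun T hT =>
  hz T fun h => hT (by simp [h])

/-! ### Lifting to a torsion free ring -/

/-- The projection from the polynomial ring over the integers on the elements of `A`. -/
def proj (A : Type*) [CommRing A] : MvPolynomial A ℤ →+* A :=
  MvPolynomial.eval₂Hom (Int.castRingHom A) id

open Classical in
/-- A lift along `proj`. -/
def lift (z : Grassmann ι A) : Grassmann ι (MvPolynomial A ℤ) := fun T =>
  if z T = 0 then 0 else MvPolynomial.X (z T)

lemma map_proj_lift (z : Grassmann ι A) : Grassmann.map (proj A) (lift z) = z := by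
  ext T
  by_cases h : z T = 0 <;> simp [lift, proj, h]

/-- Degrees survive because `lift` sends a zero coefficient to `0` and not to the variable `X 0`. -/
lemma IsHom.lift (hz : IsHom p z) : IsHom p (lift z) := fun T hT =>
  hz T fun h => hT (by simp [Grassmann.lift, h])

/-- Polynomial rings over the integers are torsion free. Together with `map_proj_lift` this permits
cancelling factorials in universal identities over any commutative ring. -/
lemma nsmul_cancel {σ : Type*} {n : ℕ} (hn : n ≠ 0) {z w : Grassmann ι (MvPolynomial σ ℤ)}
    (h : n • z = n • w) : z = w := by
  refine Grassmann.ext fun T => ?_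
  have := congrFun h T
  rw [nsmul_apply, nsmul_apply] at this
  exact smul_right_injective (MvPolynomial σ ℤ) hn this

/-- Graded commutativity gives only `2 z² = 0`; the lift removes the factor `2`. -/
lemma IsHom.mul_self (hz : IsHom p z) (hp : Odd p) : z * z = 0 := by
  suffices h : Grassmann.lift z * Grassmann.lift z = 0 by
    rw [← map_proj_lift z, ← map_mul, h, map_zero]
  refine nsmul_cancel two_ne_zero ?_
  have := hz.lift.mul_comm hz.lift
  rw [(hp.mul hp).neg_one_pow, neg_one_zsmul] at this
  rw [two_nsmul, smul_zero]
  exact eq_neg_iff_add_eq_zero.mp this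

lemma IsHom.pow_eq_zero (hz : IsHom p z) (hp : Odd p) (k : ℕ) : z ^ (k + 2) = 0 := by
  rw [pow_add, pow_two, hz.mul_self hp, mul_zero]

/-- If one factor is even, the factors commute. If both are odd, both sides vanish for exponents at
least `2`. -/
lemma IsHom.mul_pow (hz : IsHom p z) (hw : IsHom q w) (k : ℕ) : (z * w) ^ k = z ^ k * w ^ k := by
  rcases Nat.even_or_odd p with hp | hp
  · exact (hz.commute hp w).mul_pow k
  rcases Nat.even_or_odd q with hq | hq
  · exact (hw.commute hq z).symm.mul_pow k
  match k with
  | 0 => simp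
  | 1 => simp
  | k + 2 =>
    have h : z * w * (z * w) = 0 := by
      rw [mul_assoc, ← mul_assoc w, hw.mul_comm hz, smul_mul_assoc, mul_smul_comm, mul_assoc z w w,
        hw.mul_self hq, mul_zero, mul_zero, smul_zero]
    rw [hz.pow_eq_zero hp, zero_mul, pow_add, pow_two, h, mul_zero]

end Hom

/-! ### Divided powers -/

section SquareZero

variable {α C : Type*} [CommRing C] [DecidableEq α]

lemma add_pow_of_mul_self_eq_zero {u : C} (hu : u * u = 0) (v : C) (k : ℕ) :
    (u + v) ^ (k + 1) = v ^ (k + 1) + (k + 1) * (u * v ^ k) := by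
  induction k with
  | zero => simp [add_comm]
  | succ k ih =>
    rw [pow_succ, ih]
    push_cast
    linear_combination ((k + 1) * v ^ k) * hu

/-- In the multinomial expansion only the squarefree products survive, each with coefficient `k!`.
-/
lemma factorial_nsmul_sum_prod {u : α → C} (hu : ∀ a, u a * u a = 0) (s : Finset α) (k : ℕ) :
    k.factorial • ∑ S ∈ s.powersetCard k, ∏ a ∈ S, u a = (∑ a ∈ s, u a) ^ k := by
  induction s using Finset.induction_on generalizing k with
  | empty =>
    cases k with
    | zero => simp
    | succ k =>
      rw [Finset.powersetCard_eq_empty.mpr (by simp)]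
      simp
  | insert a s ha ih =>
    cases k with
    | zero => simp
    | succ k =>
      have hins : ∑ S ∈ (s.powersetCard k).image (insert a), ∏ a ∈ S, u a =
          u a * ∑ S ∈ s.powersetCard k, ∏ a ∈ S, u a := by
        have hmem : ∀ S ∈ s.powersetCard k, a ∉ S := fun S hS h =>
          ha ((Finset.mem_powersetCard.mp hS).1 h)
        rw [Finset.sum_image, Finset.mul_sum]
        · exact Finset.sum_congr rfl fun S hS => Finset.prod_insert (hmem S hS)
        · intro S hS S' hS' h
          rw [← Finset.erase_insert (hmem S hS), h, Finset.erase_insert (hmem S' hS')]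
      rw [Finset.powersetCard_succ_insert ha, Finset.sum_union, hins, Finset.sum_insert ha,
        add_pow_of_mul_self_eq_zero (hu a), ← ih, ← ih, smul_add, Nat.factorial_succ]
      · simp only [nsmul_eq_mul]
        push_cast
        ring
      · rw [Finset.disjoint_left]
        intro S hS hS'
        obtain ⟨S', _, rfl⟩ := Finset.mem_image.mp hS'
        exact ha ((Finset.mem_powersetCard.mp hS).1 (Finset.mem_insert_self _ _))

end SquareZero

/-! ### Divided powers as elementary symmetric functions of monomials -/

section DividedPowers

variable {ι κ A B : Type*} [LinearOrder ι] [LinearOrder κ] [CommRing A] [CommRing B]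

lemma isHom_mono (T : Finset ι) (a : A) : IsHom T.card (mono T a) := fun U hU => by
  by_contra h
  exact hU (by rw [mono_apply, if_neg fun e : U = T => h (e ▸ rfl)])

lemma map_mono (φ : A →+* B) (T : Finset ι) (a : A) : map φ (mono T a) = mono T (φ a) := by
  ext U
  simp only [map_apply, mono_apply]
  split_ifs <;> simp

open Classical in
/-- The monomial of `z` at a non-empty set of even cardinality, as a central element. -/
def term (z : Grassmann ι A) (T : Finset ι) : Subring.center (Grassmann ι A) :=
  if h : Even T.card ∧ T.Nonempty then
    ⟨mono T (z T), Subring.mem_center_iff.mpr fun w => ((isHom_mono T (z T)).commute h.1 w).eq.symm⟩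
  else 0

lemma term_mul_self (z : Grassmann ι A) (T : Finset ι) : term z T * term z T = 0 := by
  by_cases h : Even T.card ∧ T.Nonempty
  · rw [term, dif_pos h]
    exact Subtype.ext (mono_mul_self h.2 _ _)
  · rw [term, dif_neg h, zero_mul]

lemma map_term (φ : A →+* B) (z : Grassmann ι A) (T : Finset ι) :
    map φ (term z T : Grassmann ι A) = term (map φ z) T := by
  by_cases h : Even T.card ∧ T.Nonempty
  · rw [term, dif_pos h, term, dif_pos h]
    exact map_mono φ T _
  · rw [term, dif_neg h, term, dif_neg h]
    exact map_zero _

lemma map_prod_term (φ : A →+* B) (z : Grassmann ι A) (S : Finset (Finset ι)) :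
    map φ ((∏ T ∈ S, term z T : Subring.center (Grassmann ι A)) : Grassmann ι A) =
      (∏ T ∈ S, term (map φ z) T : Subring.center (Grassmann ι B)) := by
  induction S using Finset.induction_on with
  | empty => exact map_one _
  | insert T S hT ih =>
    rw [Finset.prod_insert hT, Finset.prod_insert hT, Subring.coe_mul, Subring.coe_mul, map_mul,
      map_term, ih]

variable [Fintype ι] [Fintype κ]

/-- The elementary symmetric function of the monomials of `z`. -/
def esymm (k : ℕ) (z : Grassmann ι A) : Grassmann ι A :=
  ∑ S ∈ (Finset.univ : Finset (Finset ι)).powersetCard k,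
    ((∏ T ∈ S, term z T : Subring.center (Grassmann ι A)) : Grassmann ι A)

/-- The divided powers of homogeneous elements of positive degree. -/
def dp : ℕ → Grassmann ι A → Grassmann ι A
  | 0, _ => 1
  | 1, z => z
  | k + 2, z => esymm (k + 2) z

@[simp] lemma dp_zero (z : Grassmann ι A) : dp 0 z = 1 := rfl
@[simp] lemma dp_one (z : Grassmann ι A) : dp 1 z = z := rfl

lemma map_esymm (φ : A →+* B) (k : ℕ) (z : Grassmann ι A) :
    map φ (esymm k z) = esymm k (map φ z) := by
  simp only [esymm, map_sum, map_prod_term]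

lemma map_dp (φ : A →+* B) (k : ℕ) (z : Grassmann ι A) : map φ (dp k z) = dp k (map φ z) :=
  match k with
  | 0 => map_one _
  | 1 => rfl
  | k + 2 => map_esymm φ (k + 2) z

variable {p q : ℕ} {z w : Grassmann ι A}

lemma IsHom.sum_term (hz : IsHom p z) (hp : Even p) (h0 : 0 < p) :
    ((∑ T : Finset ι, term z T : Subring.center (Grassmann ι A)) : Grassmann ι A) = z := by
  rw [AddSubmonoidClass.coe_finsetSum]
  ext W
  rw [sum_apply, Finset.sum_eq_single W]
  · by_cases h : Even W.card ∧ W.Nonempty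
    · rw [term, dif_pos h]
      simp [mono_apply]
    · rw [term, dif_neg h]
      by_contra hW
      have h1 := hz W (Ne.symm hW)
      exact h ⟨h1 ▸ hp, Finset.card_pos.mp (h1 ▸ h0)⟩
  · intro T _ hT
    by_cases h : Even T.card ∧ T.Nonempty
    · rw [term, dif_pos h]
      simp [mono_apply, hT.symm]
    · rw [term, dif_neg h]
      rfl
  · simp

lemma IsHom.factorial_nsmul_esymm (hz : IsHom p z) (hp : Even p) (h0 : 0 < p) (k : ℕ) :
    k.factorial • esymm k z = z ^ k := by
  have := congrArg (Subring.subtype _) (factorial_nsmul_sum_prod (term_mul_self z) Finset.univ k)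
  rw [map_nsmul, map_sum, map_pow] at this
  rw [esymm]
  refine this.trans ?_
  congr 1
  exact hz.sum_term hp h0

/-- In odd degree all `term z T` vanish, so `esymm 1 z` is `0` and not `z`. This is why `dp`
prescribes its value at index `1`. -/
lemma IsHom.esymm_eq_dp (hz : IsHom p z) (hp : Even p) (h0 : 0 < p) (k : ℕ) :
    esymm k z = dp k z :=
  match k with
  | 0 => by simpa using hz.factorial_nsmul_esymm hp h0 0
  | 1 => by simpa using hz.factorial_nsmul_esymm hp h0 1
  | k + 2 => rfl

lemma IsHom.dp_eq_zero (hz : IsHom p z) (hp : Odd p) (k : ℕ) : dp (k + 2) z = 0 := by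
  have h : ∀ T, term z T = 0 := fun T => by
    by_cases h : Even T.card ∧ T.Nonempty
    · have h0 : z T = 0 := by
        by_contra h0
        exact Nat.not_even_iff_odd.mpr hp (hz T h0 ▸ h.1)
      rw [term, dif_pos h]
      refine Subtype.ext ?_
      ext U
      simp [mono_apply, h0]
    · rw [term, dif_neg h]
  refine Finset.sum_eq_zero fun S hS => ?_
  have hS' : S.Nonempty := Finset.card_pos.mp (by rw [(Finset.mem_powersetCard.mp hS).2]; omega)
  obtain ⟨T, hT⟩ := hS'
  rw [Finset.prod_eq_zero hT (h T)]
  rfl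

/-- Over torsion free coefficients this determines `dp`. The identities below follow the same
pattern: lift, multiply by factorials, compare powers, cancel. -/
lemma IsHom.factorial_nsmul_dp (hz : IsHom p z) (h0 : 0 < p) (k : ℕ) :
    k.factorial • dp k z = z ^ k := by
  rcases Nat.even_or_odd p with hp | hp
  · rw [← hz.esymm_eq_dp hp h0, hz.factorial_nsmul_esymm hp h0]
  · match k with
    | 0 => simp
    | 1 => simp
    | k + 2 => rw [hz.dp_eq_zero hp, hz.pow_eq_zero hp, smul_zero]

lemma IsHom.dp (hz : IsHom p z) (h0 : 0 < p) (k : ℕ) : IsHom (k * p) (dp k z) := by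
  suffices h : IsHom (k * p) (Grassmann.dp k (Grassmann.lift z)) by
    rw [← map_proj_lift z, ← map_dp]
    exact h.map _
  intro T hT
  refine (hz.lift.pow k) T ?_
  rw [← hz.lift.factorial_nsmul_dp h0, nsmul_apply]
  exact smul_ne_zero k.factorial_ne_zero hT

lemma IsHom.dp_add (hz : IsHom p z) (hw : IsHom p w) (hp : Even p) (h0 : 0 < p) (k : ℕ) :
    Grassmann.dp k (z + w) = ∑ x ∈ Finset.HasAntidiagonal.antidiagonal k, Grassmann.dp x.1 z * Grassmann.dp x.2 w := by
  rw [← map_proj_lift z, ← map_proj_lift w, ← map_add]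
  simp only [← map_dp, ← map_mul, ← map_sum]
  congr 1
  refine nsmul_cancel k.factorial_ne_zero ?_
  rw [(hz.lift.add hw.lift).factorial_nsmul_dp h0, (hz.lift.commute hp _).add_pow', Finset.smul_sum]
  refine Finset.sum_congr rfl fun x hx => ?_
  obtain rfl := Finset.HasAntidiagonal.mem_antidiagonal.mp hx
  rw [← hz.lift.factorial_nsmul_dp h0, ← hw.lift.factorial_nsmul_dp h0, smul_mul_smul_comm, smul_smul,
    ← mul_assoc, Nat.choose_symm_add, Nat.add_choose_mul_factorial_mul_factorial]

lemma IsHom.dp_mul_dp (hz : IsHom p z) (h0 : 0 < p) (i j : ℕ) :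
    Grassmann.dp i z * Grassmann.dp j z = (i + j).choose i • Grassmann.dp (i + j) z := by
  rw [← map_proj_lift z]
  simp only [← map_dp, ← map_mul, ← map_nsmul]
  congr 1
  refine nsmul_cancel (mul_ne_zero i.factorial_ne_zero j.factorial_ne_zero) ?_
  rw [← smul_mul_smul_comm, hz.lift.factorial_nsmul_dp h0, hz.lift.factorial_nsmul_dp h0, smul_smul,
    _root_.mul_comm (i.factorial * j.factorial), ← mul_assoc, Nat.choose_symm_add, Nat.add_choose_mul_factorial_mul_factorial, hz.lift.factorial_nsmul_dp h0,
    pow_add]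

lemma IsHom.dp_mul_eq_pow_mul (hz : IsHom p z) (hw : IsHom q w) (h0 : 0 < q) (k : ℕ) :
    Grassmann.dp k (z * w) = z ^ k * Grassmann.dp k w := by
  rw [← map_proj_lift z, ← map_proj_lift w]
  simp only [← map_dp, ← map_mul, ← map_pow]
  congr 1
  refine nsmul_cancel k.factorial_ne_zero ?_
  rw [(hz.lift.mul hw.lift).factorial_nsmul_dp (by omega), ← mul_smul_comm,
    hw.lift.factorial_nsmul_dp h0, hz.lift.mul_pow hw.lift]

lemma IsHom.dp_mul_eq_mul_pow (hz : IsHom p z) (hw : IsHom q w) (h0 : 0 < p) (k : ℕ) :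
    Grassmann.dp k (z * w) = Grassmann.dp k z * w ^ k := by
  rw [← map_proj_lift z, ← map_proj_lift w]
  simp only [← map_dp, ← map_mul, ← map_pow]
  congr 1
  refine nsmul_cancel k.factorial_ne_zero ?_
  rw [(hz.lift.mul hw.lift).factorial_nsmul_dp (by omega), ← smul_mul_assoc,
    hz.lift.factorial_nsmul_dp h0, hz.lift.mul_pow hw.lift]

lemma IsHom.dp_mul (hz : IsHom p z) (hw : IsHom q w) (h0 : 0 < p) (h0' : 0 < q) (k : ℕ) :
    Grassmann.dp k (z * w) = k.factorial • (Grassmann.dp k z * Grassmann.dp k w) := by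
  rw [hz.dp_mul_eq_pow_mul hw h0', ← smul_mul_assoc, hz.factorial_nsmul_dp h0]

/-- A scalar multiple is a product with the element `a • 1` of degree `0`. -/
lemma IsHom.dp_smul (hz : IsHom p z) (h0 : 0 < p) (a : A) (k : ℕ) :
    Grassmann.dp k (a • z) = a ^ k • Grassmann.dp k z := by
  have := (isHom_one.smul a).dp_mul_eq_pow_mul hz h0 k
  rwa [smul_mul_assoc, one_mul, smul_pow, one_pow, smul_mul_assoc, one_mul] at this

lemma IsHom.dp_dp (hz : IsHom p z) (h0 : 0 < p) (i : ℕ) {j : ℕ} (hj : 0 < j) :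
    Grassmann.dp i (Grassmann.dp j z) =
      ((i * j).factorial / (i.factorial * j.factorial ^ i)) • Grassmann.dp (i * j) z := by
  rw [← map_proj_lift z]
  simp only [← map_dp, ← map_nsmul]
  congr 1
  refine nsmul_cancel (mul_ne_zero i.factorial_ne_zero (pow_ne_zero i j.factorial_ne_zero)) ?_
  have hdvd : i.factorial * j.factorial ^ i ∣ (i * j).factorial := by
    -- The quotient is an integer because it counts the partitions of a set of `i * j` elements into
    -- `i` parts of size `j`.
    rw [← Nat.uniformBell_mul_eq i hj.ne']
    exact ⟨i.uniformBell j, by ring⟩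
  rw [smul_smul, Nat.mul_div_cancel' hdvd, hz.lift.factorial_nsmul_dp h0, _root_.mul_comm i.factorial, mul_smul,
    (hz.lift.dp h0 j).factorial_nsmul_dp (Nat.mul_pos hj h0), ← smul_pow,
    hz.lift.factorial_nsmul_dp h0, ← pow_mul, _root_.mul_comm]

lemma lift_restrict (f : κ ↪o ι) (z : Grassmann ι A) :
    restrict f (Grassmann.lift z) = Grassmann.lift (restrict f z) := rfl

lemma IsHom.restrict_dp (hz : IsHom p z) (h0 : 0 < p) (f : κ ↪o ι) (k : ℕ) :
    Grassmann.restrict f (Grassmann.dp k z) = Grassmann.dp k (Grassmann.restrict f z) := by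
  suffices h : Grassmann.restrict f (Grassmann.dp k (Grassmann.lift z)) =
      Grassmann.dp k (Grassmann.restrict f (Grassmann.lift z)) by
    have h' := congrArg (Grassmann.map (proj A)) h
    rw [map_dp, lift_restrict, map_proj_lift] at h'
    rw [← h']
    conv_lhs => rw [← map_proj_lift z, ← map_dp]
    rfl
  refine nsmul_cancel k.factorial_ne_zero ?_
  rw [(hz.lift.restrict f).factorial_nsmul_dp h0, ← map_nsmul, hz.lift.factorial_nsmul_dp h0, map_pow]

/-! ### Contractions of divided powers -/

lemma contr_one (l : ι → ℤ) : contr l (1 : Grassmann ι A) = 0 := by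
  have := contr_mul l (1 : Grassmann ι A) 1
  rwa [isHom_one.bar Even.zero, mul_one, one_mul, mul_one, left_eq_add] at this

lemma IsHom.contr_pow (hz : IsHom p z) (hp : Even p) (l : ι → ℤ) (k : ℕ) :
    contr l (z ^ (k + 1)) = (k + 1) • (contr l z * z ^ k) := by
  induction k with
  | zero => simp
  | succ k ih =>
    rw [pow_succ', contr_mul, hz.bar hp, ih, mul_smul_comm, ← mul_assoc, (hz.commute hp _).eq,
      mul_assoc, ← pow_succ', ← succ_nsmul' (contr l z * z ^ (k + 1))]

/-- The chain rule for divided powers: the factor `k + 1` from differentiating the power turns `(k +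
1)!` into `k!`. -/
lemma IsHom.contr_dp_succ (hz : IsHom p z) (hp : Even p) (h0 : 0 < p) (l : ι → ℤ) (k : ℕ) :
    contr l (Grassmann.dp (k + 1) z) = contr l z * Grassmann.dp k z := by
  rw [← map_proj_lift z]
  simp only [← map_dp, contr_map, ← map_mul]
  congr 1
  refine nsmul_cancel (k + 1).factorial_ne_zero ?_
  rw [← map_nsmul, hz.lift.factorial_nsmul_dp h0, hz.lift.contr_pow hp, Nat.factorial_succ, mul_smul,
    ← mul_smul_comm k.factorial, hz.lift.factorial_nsmul_dp h0]

lemma IsHom.contr_dp (hz : IsHom p z) (h0 : 0 < p) {l : ι → ℤ} (h : contr l z = 0) (k : ℕ) :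
    contr l (Grassmann.dp k z) = 0 := by
  cases k with
  | zero => exact contr_one l
  | succ k =>
    rcases Nat.even_or_odd p with hp | hp
    · rw [hz.contr_dp_succ hp h0, h, zero_mul]
    · cases k with
      | zero => exact h
      | succ k => rw [hz.dp_eq_zero hp, map_zero]

end DividedPowers

end Grassmann

open CategoryTheory MonoidalCategory Opposite Simplicial TensorProduct

/-! ### Counting steps -/

lemma stepMap_val {m k : ℕ} (T : Finset (Fin m)) (hT : T.card = k) (t : Fin (m + 1)) :
    ((stepMap T hT).toOrderHom t).val = (T.filter fun s => s.val < t.val).card := rfl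

lemma hom_ext_val {m n : ℕ} {f g : ⦋m⦌ ⟶ ⦋n⦌}
    (h : ∀ t : Fin (m + 1), (f.toOrderHom t).val = (g.toOrderHom t).val) : f = g :=
  SimplexCategory.Hom.ext _ _ (OrderHom.ext _ _ (funext fun t => Fin.ext (h t)))

lemma comp_val {m n k : ℕ} (f : ⦋m⦌ ⟶ ⦋n⦌) (g : ⦋n⦌ ⟶ ⦋k⦌) (t : Fin (m + 1)) :
    (f ≫ g).toOrderHom t = g.toOrderHom (f.toOrderHom t) := rfl

lemma stepMap_univ (m : ℕ) : stepMap (Finset.univ : Finset (Fin m)) (by simp) = 𝟙 ⦋m⦌ := by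
  refine hom_ext_val fun t => ?_
  rw [stepMap_val]
  rw [Fin.card_filter_val_lt]
  exact min_eq_right (Nat.le_of_lt_succ t.2)

/-- The operator of the image of an order embedding. -/
abbrev embMap {r m : ℕ} (f : Fin r ↪o Fin m) : ⦋m⦌ ⟶ ⦋r⦌ :=
  stepMap (Finset.univ.map f.toEmbedding) (by simp)

/-- As `f` is increasing, `f s < t` holds exactly when `s` is less than the number of `s'` with `f
s' < t`. -/
lemma stepMap_map {r m k : ℕ} (f : Fin r ↪o Fin m) (T : Finset (Fin r)) (hT : T.card = k) :
    stepMap (T.map f.toEmbedding) (by simpa using hT) = embMap f ≫ stepMap T hT := by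
  refine hom_ext_val fun t => ?_
  rw [comp_val, stepMap_val, stepMap_val, stepMap_val, Finset.filter_map, Finset.card_map,
    Finset.filter_map, Finset.card_map]
  congr 1
  refine Finset.filter_congr fun s _ => ?_
  simp only [Function.comp_apply]
  constructor
  · intro h
    have : (Finset.Iic s).card ≤
        (Finset.univ.filter fun s' => (f.toEmbedding s').val < t.val).card :=
      Finset.card_le_card fun s' hs' => by
        simp only [Finset.mem_filter, Finset.mem_univ, true_and]
        exact lt_of_le_of_lt (Fin.le_def.mp (f.monotone (Finset.mem_Iic.mp hs'))) h
    rw [Fin.card_Iic] at this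
    exact this
  · intro h
    by_contra h'
    have : (Finset.univ.filter fun s' => (f.toEmbedding s').val < t.val).card ≤
        (Finset.Iio s).card :=
      Finset.card_le_card fun s' hs' => by
        simp only [Finset.mem_filter, Finset.mem_univ, true_and] at hs'
        rw [Finset.mem_Iio]
        by_contra hlt
        exact h' (lt_of_le_of_lt (Fin.le_def.mp (f.monotone (not_lt.mp hlt))) hs')
    rw [Fin.card_Iio] at this
    exact absurd h (not_lt.mpr this)

/-- The steps `s` and `s'` are those before and after the vertex `j`. Exchanging them changes the
count only at `j`, which `f` omits. -/
lemma comp_stepMap_insert {k m p : ℕ} {f : ⦋k⦌ ⟶ ⦋m⦌} {j : Fin (m + 1)}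
    (hf : ∀ t : Fin (k + 1), f.toOrderHom t ≠ j) {T : Finset (Fin m)} {s s' : Fin m}
    (hs : s.val + 1 = j.val) (hs' : s'.val = j.val) (hT : s ∉ T) (hT' : s' ∉ T)
    (h : (insert s T).card = p) (h' : (insert s' T).card = p) :
    f ≫ stepMap (insert s T) h = f ≫ stepMap (insert s' T) h' := by
  refine hom_ext_val fun t => ?_
  rw [comp_val, comp_val, stepMap_val, stepMap_val, Finset.filter_insert, Finset.filter_insert]
  have hne : (f.toOrderHom t).val ≠ j.val := fun h => hf t (Fin.ext h)
  have hiff : s.val < (f.toOrderHom t).val ↔ s'.val < (f.toOrderHom t).val := by omega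
  by_cases hlt : s'.val < (f.toOrderHom t).val
  · rw [if_pos (hiff.mpr hlt), if_pos hlt, Finset.card_insert_of_notMem, Finset.card_insert_of_notMem]
    · simp [hT']
    · simp [hT]
  · rw [if_neg (mt hiff.mp hlt), if_neg hlt]

/-- When the steps next to `j` all lie in `U`, the surjection changes its value on both sides of
`j`; so no other vertex has the same image, and omission of a vertex is preserved. -/
lemma comp_stepMap_ne {k m p : ℕ} {f : ⦋k⦌ ⟶ ⦋m⦌} {j : Fin (m + 1)}
    (hf : ∀ t : Fin (k + 1), f.toOrderHom t ≠ j) {U : Finset (Fin m)} (h : U.card = p)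
    (hU : ∀ s : Fin m, s.val + 1 = j.val ∨ s.val = j.val → s ∈ U) (t : Fin (k + 1)) :
    (f ≫ stepMap U h).toOrderHom t ≠ (stepMap U h).toOrderHom j := by
  intro he
  have he' := congrArg Fin.val he
  rw [comp_val, stepMap_val, stepMap_val] at he'
  have hne : (f.toOrderHom t).val ≠ j.val := fun h => hf t (Fin.ext h)
  have hb : (f.toOrderHom t).val < m + 1 := (f.toOrderHom t).2
  have hj := j.2
  rcases lt_or_gt_of_ne hne with hlt | hlt
  · refine absurd he' (ne_of_lt (Finset.card_lt_card ?_))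
    rw [Finset.ssubset_iff_of_subset]
    · refine ⟨⟨j.val - 1, by omega⟩, ?_, ?_⟩
      · simp only [Finset.mem_filter]
        exact ⟨hU _ (Or.inl (show j.val - 1 + 1 = j.val by omega)),
          show j.val - 1 < j.val by omega⟩
      · simp only [Finset.mem_filter, not_and, not_lt]
        intro _
        change (f.toOrderHom t).val ≤ j.val - 1
        omega
    · intro s hs
      simp only [Finset.mem_filter] at hs ⊢
      exact ⟨hs.1, hs.2.trans hlt⟩
  · refine absurd he'.symm (ne_of_lt (Finset.card_lt_card ?_))
    rw [Finset.ssubset_iff_of_subset]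
    · refine ⟨⟨j.val, by omega⟩, ?_, ?_⟩
      · simp only [Finset.mem_filter]
        exact ⟨hU _ (Or.inr rfl), hlt⟩
      · simp
    · intro s hs
      simp only [Finset.mem_filter] at hs ⊢
      exact ⟨hs.1, hs.2.trans hlt⟩

lemma stepMap_ne_zero {m p : ℕ} {j : Fin (m + 1)} (hj : j ≠ 0) {U : Finset (Fin m)}
    (h : U.card = p) (hU : ∀ s : Fin m, s.val + 1 = j.val ∨ s.val = j.val → s ∈ U) :
    (stepMap U h).toOrderHom j ≠ 0 := by
  intro he
  have he' := congrArg Fin.val he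
  rw [stepMap_val] at he'
  have hj0 : j.val ≠ 0 := fun h => hj (Fin.ext h)
  have hj' := j.2
  have hmem : (⟨j.val - 1, by omega⟩ : Fin m) ∈ U.filter fun s => s.val < j.val := by
    simp only [Finset.mem_filter]
    exact ⟨hU _ (Or.inl (show j.val - 1 + 1 = j.val by omega)),
          show j.val - 1 < j.val by omega⟩
  rw [Finset.card_eq_zero.mp he'] at hmem
  simp at hmem

/-- The embedding of the steps of `[m]` as the steps of `[m + 1]` other than the first one. -/
abbrev succSet {m : ℕ} (T : Finset (Fin m)) : Finset (Fin (m + 1)) :=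
  T.map (Fin.succOrderEmb m).toEmbedding

lemma zero_notMem_succSet {m : ℕ} (T : Finset (Fin m)) : (0 : Fin (m + 1)) ∉ succSet T := by
  simp [succSet, Fin.succ_ne_zero]

lemma δ_zero_val {m : ℕ} (t : Fin (m + 1)) :
    ((SimplexCategory.δ (0 : Fin (m + 2))).toOrderHom t).val = t.val + 1 := rfl

lemma card_filter_succSet {m : ℕ} (T : Finset (Fin m)) (t : ℕ) :
    ((succSet T).filter fun s => s.val < t + 1).card = (T.filter fun s => s.val < t).card := by
  rw [Finset.filter_map, Finset.card_map]
  congr 1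
  refine Finset.filter_congr fun s _ => ?_
  simp

lemma δ_comp_stepMap_succSet {m p : ℕ} (T : Finset (Fin m)) (hT : T.card = p) :
    SimplexCategory.δ (0 : Fin (m + 2)) ≫ stepMap (succSet T) (by simpa using hT) =
      stepMap T hT := by
  refine hom_ext_val fun t => ?_
  rw [comp_val, stepMap_val, stepMap_val, δ_zero_val, card_filter_succSet]

lemma δ_comp_stepMap_insert {m p : ℕ} (T : Finset (Fin m)) (hT : T.card = p)
    (h : (insert 0 (succSet T)).card = p + 1) :
    SimplexCategory.δ (0 : Fin (m + 2)) ≫ stepMap (insert 0 (succSet T)) h =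
      stepMap T hT ≫ SimplexCategory.δ (0 : Fin (p + 2)) := by
  refine hom_ext_val fun t => ?_
  rw [comp_val, comp_val, stepMap_val, δ_zero_val, δ_zero_val, stepMap_val, Finset.filter_insert,
    if_pos (by simp), Finset.card_insert_of_notMem, card_filter_succSet]
  simp only [Finset.mem_filter, not_and]
  exact fun h => absurd h (zero_notMem_succSet T)

/-! ### Contractions for a vertex -/

/-- The linear form on steps whose kernel is generated by the steps that remain when the `j`-th
vertex is omitted. -/
def vertexForm {m : ℕ} (j : Fin (m + 1)) (s : Fin m) : ℤ :=
  (if s.val + 1 = j.val then 1 else 0) - if s.val = j.val then 1 else 0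

open Grassmann

lemma exists_vertexForm_mul_self {m : ℕ} (hm : 0 < m) (j : Fin (m + 1)) :
    ∃ s, vertexForm j s * vertexForm j s = 1 := by
  have := j.2
  by_cases hj : j.val = 0
  · exact ⟨⟨0, hm⟩, by simp [vertexForm, hj]⟩
  · refine ⟨⟨j.val - 1, by omega⟩, ?_⟩
    have h1 : j.val - 1 + 1 = j.val := by omega
    have h2 : j.val - 1 ≠ j.val := by omega
    simp [vertexForm, h1, h2]

/-- The coefficient at `T` involves only the steps next to `j` that are not in `T`. If two are
missing, their contributions cancel by `h1`: the form has opposite signs there, and no other step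
lies between them. If only one is missing, inserting it makes `h2` applicable. -/
lemma contr_vertexForm_eq_zero {m : ℕ} {B : Type*} [CommRing B] {z : Grassmann (Fin m) B}
    (j : Fin (m + 1))
    (h1 : ∀ (T : Finset (Fin m)) (s s' : Fin m), s.val + 1 = j.val → s'.val = j.val →
      s ∉ T → s' ∉ T → z (insert s T) = z (insert s' T))
    (h2 : ∀ U : Finset (Fin m), (∀ s : Fin m, s.val + 1 = j.val ∨ s.val = j.val → s ∈ U) →
      z U = 0) : contr (vertexForm j) z = 0 := by
  ext T
  rw [contr_apply, Grassmann.sum_apply, Grassmann.zero_apply]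
  have heps : ∀ s s' : Fin m, s.val + 1 = j.val → s'.val = j.val → s ∉ T → s' ∉ T →
      contr₁ s z T = contr₁ s' z T := by
    intro s s' hs hs' hT hT'
    have : eps {s} T = eps {s'} T := by
      simp only [eps, Finset.prod_singleton]
      refine Finset.prod_congr rfl fun u hu => ?_
      have h3 : u.val ≠ s.val := fun h => hT (Fin.ext h ▸ hu)
      have h4 : u.val ≠ s'.val := fun h => hT' (Fin.ext h ▸ hu)
      have : u < s ↔ u < s' := by rw [Fin.lt_def, Fin.lt_def]; omega
      simp only [this]
    rw [contr₁, contr₁, if_neg hT, if_neg hT', this, h1 T s s' hs hs' hT hT']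
  by_cases hall : ∀ s : Fin m, s.val + 1 = j.val ∨ s.val = j.val → contr₁ s z T = 0
  · refine Finset.sum_eq_zero fun s _ => ?_
    rw [zsmul_apply]
    by_cases hs : s.val + 1 = j.val ∨ s.val = j.val
    · rw [hall s hs, smul_zero]
    · rw [vertexForm, if_neg (fun h => hs (Or.inl h)), if_neg (fun h => hs (Or.inr h)), sub_zero,
        zero_smul]
  · push Not at hall
    obtain ⟨s, hs, hne⟩ := hall
    have hsT : s ∉ T := fun h => hne (by rw [contr₁, if_pos h])
    have hz : z (insert s T) ≠ 0 := fun h => hne (by rw [contr₁, if_neg hsT, h, mul_zero])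
    -- A nonzero contribution of `s` forces a second adjacent step outside `T`.
    have := mt (h2 (insert s T)) hz
    push Not at this
    obtain ⟨s', hs', hne'⟩ := this
    rw [Finset.mem_insert, not_or] at hne'
    have hss : s'.val ≠ s.val := fun h => hne'.1 (Fin.ext h)
    rw [Finset.sum_eq_add s s' (fun h => hss (by rw [h])) _ (by simp) (by simp), zsmul_apply,
      zsmul_apply]
    · rcases hs with hs | hs
      · have hs'' : s'.val = j.val := by omega
        rw [heps s s' hs hs'' hsT hne'.2, vertexForm, vertexForm, if_pos hs, if_neg (by omega),
          if_neg (by omega), if_pos hs'']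
        simp
      · have hs'' : s'.val + 1 = j.val := by omega
        rw [← heps s' s hs'' hs hne'.2 hsT, vertexForm, vertexForm, if_neg (by omega), if_pos hs,
          if_pos hs'', if_neg (by omega)]
        simp
    · rintro t _ ⟨h3, h4⟩
      have h3' : t.val ≠ s.val := fun h => h3 (Fin.ext h)
      have h4' : t.val ≠ s'.val := fun h => h4 (Fin.ext h)
      rw [zsmul_apply, vertexForm, if_neg (by omega), if_neg (by omega), sub_zero, zero_smul]

/-- The form of the vertex `0` is minus the coordinate of the step `0`. This is the smallest step,
so inserting it costs no sign. -/
lemma contr_vertexForm_zero_apply {m : ℕ} {B : Type*} [CommRing B] (z : Grassmann (Fin (m + 1)) B)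
    (T : Finset (Fin m)) :
    contr (vertexForm 0) z (succSet T) = -z (insert 0 (succSet T)) := by
  rw [contr_apply, Grassmann.sum_apply, Finset.sum_eq_single 0]
  · have : eps {0} (succSet T) = 1 := by
      rw [eps, Finset.prod_singleton]
      exact Finset.prod_eq_one fun u _ => by simp
    rw [zsmul_apply, contr₁, if_neg (zero_notMem_succSet T), this]
    simp [vertexForm]
  · intro s _ hs
    have : s.val ≠ 0 := fun h => hs (Fin.ext h)
    simp [zsmul_apply, vertexForm, this]
  · simp

/-! ### Simplicial commutative algebras -/

/-- The structure of a simplicial commutative algebra on a sequence of commutative algebras. -/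
structure SimplicialAlgebra (R : Type u) [CommRing R] (A : ℕ → Type v) [∀ n, CommRing (A n)]
    [∀ n, Algebra R (A n)] where
  /-- the simplicial operators -/
  map : ∀ {m n : ℕ}, (⦋m⦌ ⟶ ⦋n⦌) → (A n →ₐ[R] A m)
  map_id : ∀ {n : ℕ} (x : A n), map (𝟙 ⦋n⦌) x = x
  map_comp : ∀ {l m n : ℕ} (f : ⦋l⦌ ⟶ ⦋m⦌) (g : ⦋m⦌ ⟶ ⦋n⦌) (x : A n), map (f ≫ g) x = map f (map g x)

namespace SimplicialAlgebra

variable {R : Type u} [CommRing R] {A : ℕ → Type v} [∀ n, CommRing (A n)] [∀ n, Algebra R (A n)]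
  (X : SimplicialAlgebra R A)

/-- The element of the Grassmann ring on the steps of `[m]` with coefficients in `A m` whose
coefficients are the degeneracies of `x`. -/
def phi (m : ℕ) {p : ℕ} (x : A p) : Grassmann (Fin m) (A m) := fun T =>
  if h : T.card = p then X.map (stepMap T h) x else 0

variable {X}

lemma phi_apply {m p : ℕ} (x : A p) {T : Finset (Fin m)} (h : T.card = p) :
    X.phi m x T = X.map (stepMap T h) x := dif_pos h

lemma isHom_phi (m : ℕ) {p : ℕ} (x : A p) : IsHom p (X.phi m x) := fun T hT => by
  by_contra h
  exact hT (dif_neg h)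

lemma phi_univ {m : ℕ} (x : A m) : X.phi m x Finset.univ = x := by
  rw [phi_apply x (by simp), stepMap_univ, X.map_id]

lemma phi_add (m : ℕ) {p : ℕ} (x y : A p) : X.phi m (x + y) = X.phi m x + X.phi m y := by
  ext T
  by_cases h : T.card = p <;> simp [phi, h]

lemma phi_zero (m p : ℕ) : X.phi m (0 : A p) = 0 := by
  ext T
  by_cases h : T.card = p <;> simp [phi, h]

lemma phi_smul (m : ℕ) {p : ℕ} (r : R) (x : A p) :
    X.phi m (r • x) = algebraMap R (A m) r • X.phi m x := by
  ext T
  by_cases h : T.card = p <;> simp [phi, h, Algebra.smul_def]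

lemma phi_one (m : ℕ) : X.phi m (1 : A 0) = 1 := by
  ext T
  by_cases h : T.card = 0
  · rw [phi_apply _ h, map_one, Grassmann.one_apply, if_pos (by simpa using h)]
  · rw [phi, dif_neg h, Grassmann.one_apply, if_neg (by simpa using h)]

lemma restrict_phi {r m p : ℕ} (f : Fin r ↪o Fin m) (x : A p) :
    restrict f (X.phi m x) = Grassmann.map (X.map (embMap f)).toRingHom (X.phi r x) := by
  ext T
  by_cases h : T.card = p
  · rw [restrict_apply, Grassmann.map_apply, phi_apply x h, phi_apply x (by simpa using h),
      stepMap_map f T h, X.map_comp]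
    rfl
  · rw [restrict_apply, Grassmann.map_apply, phi, phi, dif_neg h, dif_neg (by simpa using h), map_zero]

/-- The coefficient at an `r`-set is the top coefficient of the restriction along its increasing
enumeration, so top coefficients suffice. -/
lemma phi_eq_of_restrict {r m : ℕ} {z : Grassmann (Fin m) (A m)} (hz : IsHom r z) (x : A r)
    (h : ∀ f : Fin r ↪o Fin m, X.map (embMap f) x = restrict f z Finset.univ) :
    X.phi m x = z := by
  ext T
  by_cases hT : T.card = r
  · have hT' : Finset.univ.map (T.orderEmbOfFin hT).toEmbedding = T := T.map_orderEmbOfFin_univ hT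
    have := h (T.orderEmbOfFin hT)
    rw [restrict_apply, hT'] at this
    rw [← this, phi_apply x hT]
    have : ∀ (T' : Finset (Fin m)) (hT' : T'.card = r), T' = T → stepMap T hT = stepMap T' hT' := by
      rintro _ _ rfl
      rfl
    rw [this _ _ hT']
  · rw [phi, dif_neg hT, not_not.mp (mt (hz T) hT)]

variable (X) in
/-- The shuffle product. -/
def sh {p q m : ℕ} (_ : p + q = m) (x : A p) (y : A q) : A m :=
  (X.phi m x * X.phi m y) Finset.univ

/-- Restriction and change of coefficients are ring homomorphisms, which reduces the claim to the
top coefficient, where it is the definition of `sh`. -/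
lemma phi_sh (m' : ℕ) {p q m : ℕ} (h : p + q = m) (x : A p) (y : A q) :
    X.phi m' (X.sh h x y) = X.phi m' x * X.phi m' y := by
  subst h
  refine phi_eq_of_restrict ((isHom_phi m' x).mul (isHom_phi m' y)) _ fun f => ?_
  rw [map_mul, restrict_phi, restrict_phi, ← map_mul]
  rfl

/-- Identities between chains can thus be checked in the exterior algebra. -/
lemma phi_injective {m : ℕ} {x y : A m} (h : X.phi m x = X.phi m y) : x = y := by
  rw [← phi_univ (X := X) x, h, phi_univ]

variable (X) in
/-- The divided powers. -/
def dpow (i : ℕ) {n m : ℕ} (_ : i * n = m) (x : A n) : A m := dp i (X.phi m x) Finset.univ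

lemma phi_dpow (m' : ℕ) (i : ℕ) {n m : ℕ} (hn : 0 < n) (h : i * n = m) (x : A n) :
    X.phi m' (X.dpow i h x) = dp i (X.phi m' x) := by
  subst h
  refine phi_eq_of_restrict ((isHom_phi m' x).dp hn i) _ fun f => ?_
  rw [(isHom_phi m' x).restrict_dp hn, restrict_phi, ← map_dp]
  rfl

/-! ### Chains and cycles -/

variable (X) in
/-- The elements that are sent to zero by all operators that omit some vertex `j`, where `j ≠ 0`
unless `b` holds. -/
def chains (b : Prop) (n : ℕ) : Submodule R (A n) where
  carrier := {x | ∀ (k : ℕ) (f : ⦋k⦌ ⟶ ⦋n⦌) (j : Fin (n + 1)), (b ∨ j ≠ 0) →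
    (∀ t : Fin (k + 1), f.toOrderHom t ≠ j) → X.map f x = 0}
  zero_mem' := fun _ _ _ _ _ => map_zero _
  add_mem' := fun hx hy k f j hj hf => by rw [map_add, hx k f j hj hf, hy k f j hj hf, add_zero]
  smul_mem' := fun r x hx k f j hj hf => by rw [map_smul, hx k f j hj hf, smul_zero]

lemma chains_le (b : Prop) (n : ℕ) : X.chains True n ≤ X.chains b n :=
  fun _ hx k f j _ hf => hx k f j (Or.inl trivial) hf

/-- Exchanging the steps around `j` does not affect an operator that omits `j`. If both are used,
the composite operator still omits a vertex, hence kills `x`. For the latter, `chains` is stated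
with all operators and not only with faces. -/
lemma contr_map_phi {b : Prop} {n m k : ℕ} {x : A n} (hx : x ∈ X.chains b n) {f : ⦋k⦌ ⟶ ⦋m⦌}
    {j : Fin (m + 1)} (hj : b ∨ j ≠ 0) (hf : ∀ t : Fin (k + 1), f.toOrderHom t ≠ j) :
    contr (vertexForm j) (Grassmann.map (X.map f).toRingHom (X.phi m x)) = 0 := by
  refine contr_vertexForm_eq_zero j (fun T s s' hs hs' hT hT' => ?_) fun U hU => ?_
  · by_cases h : T.card + 1 = n
    · have h1 := (Finset.card_insert_of_notMem hT).trans h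
      have h2 := (Finset.card_insert_of_notMem hT').trans h
      rw [Grassmann.map_apply, Grassmann.map_apply, phi_apply x h1, phi_apply x h2]
      change X.map f _ = X.map f _
      rw [← X.map_comp, ← X.map_comp, comp_stepMap_insert hf hs hs' hT hT' h1 h2]
    · rw [Grassmann.map_apply, Grassmann.map_apply, phi, phi, dif_neg, dif_neg]
      · rwa [Finset.card_insert_of_notMem hT']
      · rwa [Finset.card_insert_of_notMem hT]
  · by_cases h : U.card = n
    · rw [Grassmann.map_apply, phi_apply x h]
      change X.map f _ = 0
      rw [← X.map_comp]
      exact hx _ _ ((stepMap U h).toOrderHom j) (hj.imp_right fun hj => stepMap_ne_zero hj h hU)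
        (comp_stepMap_ne hf h hU)
    · rw [Grassmann.map_apply, phi, dif_neg h, map_zero]

lemma pos_of_forall_ne {m k : ℕ} {f : ⦋k⦌ ⟶ ⦋m⦌} {j : Fin (m + 1)}
    (hf : ∀ t : Fin (k + 1), f.toOrderHom t ≠ j) : 0 < m := by
  have h1 : (f.toOrderHom (0 : Fin (k + 1))).val ≠ j.val := fun h => hf 0 (Fin.ext h)
  have h2 : (f.toOrderHom (0 : Fin (k + 1))).val < m + 1 := (f.toOrderHom (0 : Fin (k + 1))).2
  have h3 := j.2
  omega

lemma sh_mem {b : Prop} {p q m : ℕ} (h : p + q = m) {x : A p} {y : A q} (hx : x ∈ X.chains b p)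
    (hy : y ∈ X.chains b q) : X.sh h x y ∈ X.chains b m := by
  intro k f j hj hf
  obtain ⟨s, hs⟩ := exists_vertexForm_mul_self (pos_of_forall_ne hf) j
  have : Grassmann.map (X.map f).toRingHom (X.phi m x * X.phi m y) Finset.univ = 0 := by
    refine apply_univ_eq_zero ?_ hs
    rw [map_mul, contr_mul, contr_map_phi hx hj hf, contr_map_phi hy hj hf, zero_mul, mul_zero,
      add_zero]
  exact this

lemma dpow_mem {b : Prop} (i : ℕ) {n m : ℕ} (hn : 0 < n) (h : i * n = m) {x : A n}
    (hx : x ∈ X.chains b n) : X.dpow i h x ∈ X.chains b m := by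
  intro k f j hj hf
  obtain ⟨s, hs⟩ := exists_vertexForm_mul_self (pos_of_forall_ne hf) j
  have : Grassmann.map (X.map f).toRingHom (dp i (X.phi m x)) Finset.univ = 0 := by
    refine apply_univ_eq_zero ?_ hs
    rw [map_dp]
    exact ((isHom_phi m x).map _).contr_dp hn (contr_map_phi hx hj hf) i
  exact this

/-! ### Boundaries -/

variable (X) in
/-- The differential of the normalized chain complex. -/
def d (n : ℕ) : A (n + 1) →ₐ[R] A n := X.map (SimplexCategory.δ (0 : Fin (n + 2)))

lemma δ_zero_ne {m : ℕ} (t : Fin (m + 1)) :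
    (SimplexCategory.δ (0 : Fin (m + 2))).toOrderHom t ≠ 0 :=
  Fin.succ_ne_zero t

lemma map_d_phi_insert {n : ℕ} (m : ℕ) (y : A (n + 1)) (T : Finset (Fin m)) :
    X.d m (X.phi (m + 1) y (insert 0 (succSet T))) = X.phi m (X.d n y) T := by
  have hc : (insert 0 (succSet T)).card = T.card + 1 := by
    rw [Finset.card_insert_of_notMem (zero_notMem_succSet T), Finset.card_map]
  by_cases h : T.card = n
  · rw [phi_apply y (hc.trans (by rw [h])), phi_apply _ h, d, d, ← X.map_comp, ← X.map_comp,
      δ_comp_stepMap_insert]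
  · rw [phi, phi, dif_neg h, dif_neg (by omega), map_zero]

lemma restrict_map_d_phi {n : ℕ} (m : ℕ) (x : A n) :
    restrict (Fin.succOrderEmb m) (Grassmann.map (X.d m).toRingHom (X.phi (m + 1) x)) =
      X.phi m x := by
  ext T
  rw [restrict_apply, Grassmann.map_apply]
  by_cases h : T.card = n
  · rw [phi_apply x (by simpa using h), phi_apply _ h, ← δ_comp_stepMap_succSet T h, X.map_comp]
    rfl
  · rw [phi, phi, dif_neg h, dif_neg (by simpa using h), map_zero]

/-- Contraction with the form of the vertex `0` extracts, up to sign, the part containing the step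
`0`. The Leibniz rule leaves only the term where `y` is contracted, since `x` is a cycle; on the
remaining steps this is `-phi (d y)` times `phi x`. -/
lemma d_sh {p q m : ℕ} (h : p + q = m) (h' : p + 1 + q = m + 1) (y : A (p + 1)) {x : A q}
    (hx : x ∈ X.chains True q) : X.d m (X.sh h' y x) = X.sh h (X.d p y) x := by
  set z := Grassmann.map (X.d m).toRingHom (X.phi (m + 1) y) with hz
  set w := Grassmann.map (X.d m).toRingHom (X.phi (m + 1) x) with hw
  have hw0 : contr (vertexForm 0) w = 0 := contr_map_phi hx (Or.inl trivial) δ_zero_ne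
  have h1 : X.d m (X.sh h' y x) = (z * w) Finset.univ := by
    rw [hz, hw, ← map_mul]
    rfl
  have h2 : insert 0 (succSet (Finset.univ : Finset (Fin m))) = Finset.univ := by
    ext t
    cases t using Fin.cases <;> simp [succSet]
  have h3 := contr_vertexForm_zero_apply (z * w) Finset.univ
  rw [h2, contr_mul, hw0, mul_zero, add_zero] at h3
  have h4 : restrict (Fin.succOrderEmb m) (contr (vertexForm 0) z) = -X.phi m (X.d p y) := by
    ext T
    rw [restrict_apply, contr_vertexForm_zero_apply, Grassmann.neg_apply, ← map_d_phi_insert]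
    rfl
  have h5 : (restrict (Fin.succOrderEmb m) (contr (vertexForm 0) z * w)) Finset.univ =
      -(z * w) Finset.univ := h3
  rw [map_mul, h4, restrict_map_d_phi, neg_mul, Grassmann.neg_apply, neg_inj] at h5
  rw [h1, ← h5]
  rfl

/-- The bounding chain is a divided power over the steps of `[m]`, but with coefficients in `A (m +
1)`: the step `0` of `[m + 1]` is inserted into every set, so that `z` has degree `n` and the
differential turns it into `phi m (d y)`. -/
lemma exists_d_eq_dpow {n m : ℕ} {i : ℕ} (hn : 0 < n) (hi : 0 < i) (h : i * n = m) {y : A (n + 1)}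
    (hy : y ∈ X.chains False (n + 1)) :
    ∃ w ∈ X.chains False (m + 1), X.d m w = X.dpow i h (X.d n y) := by
  let z : Grassmann (Fin m) (A (m + 1)) := fun T => X.phi (m + 1) y (insert 0 (succSet T))
  have hz : IsHom n z := fun T hT => by
    have := isHom_phi _ _ _ hT
    rw [Finset.card_insert_of_notMem (zero_notMem_succSet T), Finset.card_map] at this
    omega
  refine ⟨dp i z Finset.univ, ?_, ?_⟩
  · intro k f j hj hf
    have hj' : j ≠ 0 := by simpa using hj
    -- The vertex `j + 1` of `[m + 1]` is tested by contracting with the form of the vertex `j` of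
    -- `[m]`.
    obtain ⟨j, rfl⟩ := Fin.exists_succ_eq.mpr hj'
    obtain ⟨s, hs⟩ := exists_vertexForm_mul_self (h ▸ Nat.mul_pos hi hn) j
    have : Grassmann.map (X.map f).toRingHom (dp i z) Finset.univ = 0 := by
      refine apply_univ_eq_zero ?_ hs
      rw [map_dp]
      refine (hz.map _).contr_dp hn ?_ i
      have hins : ∀ (s : Fin m) (T : Finset (Fin m)),
          insert 0 (succSet (insert s T)) = insert s.succ (insert 0 (succSet T)) := fun s T => by
        rw [succSet, Finset.map_insert, Finset.insert_comm]
        rfl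
      have hmem : ∀ (s : Fin m) (T : Finset (Fin m)),
          s ∉ T → s.succ ∉ insert 0 (succSet T) := fun s T hs => by
        simpa [succSet, Fin.succ_ne_zero] using hs
      refine contr_vertexForm_eq_zero j (fun T s s' hs hs' hT hT' => ?_) fun U hU => ?_
      · change X.map f (X.phi _ _ _) = X.map f (X.phi _ _ _)
        rw [hins, hins]
        have h1 := Finset.card_insert_of_notMem (hmem s T hT)
        have h2 := Finset.card_insert_of_notMem (hmem s' T hT')
        by_cases hc : (insert 0 (succSet T)).card + 1 = n + 1
        · rw [phi_apply y (h1.trans hc), phi_apply y (h2.trans hc), ← X.map_comp, ← X.map_comp]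
          rw [comp_stepMap_insert hf (by simpa using hs) (by simpa using hs') (hmem s T hT)
            (hmem s' T hT')]
        · rw [phi, phi, dif_neg (by omega), dif_neg (by omega)]
      · change X.map f (X.phi _ _ _) = 0
        by_cases hc : (insert 0 (succSet U)).card = n + 1
        · have hU' : ∀ s : Fin (m + 1), s.val + 1 = j.succ.val ∨ s.val = j.succ.val →
              s ∈ insert 0 (succSet U) := fun s hs => by
            cases s using Fin.cases with
            | zero => simp
            | succ s =>
              have := hU s (by simpa using hs)
              simp [succSet, this]
          rw [phi_apply y hc, ← X.map_comp]
          exact hy _ _ _ (Or.inr (stepMap_ne_zero hj' hc hU')) (comp_stepMap_ne hf hc hU')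
        · rw [phi, dif_neg hc, map_zero]
    exact this
  · have : Grassmann.map (X.d m).toRingHom z = X.phi m (X.d n y) :=
      Grassmann.ext fun T => map_d_phi_insert m y T
    rw [dpow, ← this, ← map_dp]
    rfl

end SimplicialAlgebra

open Grassmann

namespace SimplicialAlgebra

variable {R : Type u} [CommRing R] {A : ℕ → Type v} [∀ n, CommRing (A n)] [∀ n, Algebra R (A n)]
  {X : SimplicialAlgebra R A}

/-! ### Operations on cycles -/

lemma mem_chains_zero (b : Prop) (x : A 0) : x ∈ X.chains b 0 := fun _ _ _ _ hf =>
  absurd (pos_of_forall_ne hf) (lt_irrefl 0)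

lemma phi_zsmul (m : ℕ) {p : ℕ} (c : ℤ) (x : A p) : X.phi m (c • x) = c • X.phi m x :=
  map_zsmul (AddMonoidHom.mk' (X.phi m (p := p)) (phi_add m)) c x

lemma phi_nsmul (m : ℕ) {p : ℕ} (c : ℕ) (x : A p) : X.phi m (c • x) = c • X.phi m x :=
  map_nsmul (AddMonoidHom.mk' (X.phi m (p := p)) (phi_add m)) c x

lemma phi_sum (m : ℕ) {p : ℕ} {α : Type*} (s : Finset α) (x : α → A p) :
    X.phi m (∑ i ∈ s, x i) = ∑ i ∈ s, X.phi m (x i) :=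
  map_sum (AddMonoidHom.mk' (X.phi m (p := p)) (phi_add m)) x s

variable (X) in
/-- The submodule of cycles. -/
abbrev cycles (n : ℕ) : Submodule R (A n) := X.chains True n

variable (X) in
/-- The shuffle product of cycles. -/
def shCycles {p q m : ℕ} (h : p + q = m) (x : X.cycles p) (y : X.cycles q) : X.cycles m :=
  ⟨X.sh h x y, sh_mem h x.2 y.2⟩

variable (X) in
/-- The divided powers of cycles. -/
def dpowCycles (i : ℕ) {n m : ℕ} (hn : 0 < n) (h : i * n = m) (x : X.cycles n) : X.cycles m :=
  ⟨X.dpow i h x, dpow_mem i hn h x.2⟩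

lemma cycles_ext {n : ℕ} {x y : X.cycles n}
    (h : X.phi n (x : A n) = X.phi n (y : A n)) : x = y := Subtype.ext (phi_injective h)

lemma phi_shCycles (m' : ℕ) {p q m : ℕ} (h : p + q = m) (x : X.cycles p) (y : X.cycles q) :
    X.phi m' (X.shCycles h x y : A m) = X.phi m' (x : A p) * X.phi m' (y : A q) := phi_sh m' h _ _

lemma phi_dpowCycles (m' i : ℕ) {n m : ℕ} (hn : 0 < n) (h : i * n = m) (x : X.cycles n) :
    X.phi m' (X.dpowCycles i hn h x : A m) = dp i (X.phi m' (x : A n)) := phi_dpow m' i hn h _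

lemma dpowCycles_add (i : ℕ) {n m : ℕ} (hn : 0 < n) (he : Even n) (h : i * n = m)
    (x y : X.cycles n) : X.dpowCycles i hn h (x + y) =
      ∑ k ∈ (Finset.HasAntidiagonal.antidiagonal i).attach,
        X.shCycles (by rw [← h, ← add_mul, Finset.HasAntidiagonal.mem_antidiagonal.mp k.2])
          (X.dpowCycles k.1.1 hn rfl x) (X.dpowCycles k.1.2 hn rfl y) := by
  refine cycles_ext ?_
  rw [phi_dpowCycles, Submodule.coe_add, phi_add, (isHom_phi m _).dp_add (isHom_phi m _) he hn,
    AddSubmonoidClass.coe_finsetSum, phi_sum, ← Finset.sum_attach]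
  refine Finset.sum_congr rfl fun k _ => ?_
  rw [phi_shCycles, phi_dpowCycles, phi_dpowCycles]

/-! ### Homology with its product and divided powers -/

variable (X) in
/-- A presentation of the homology of `X`. -/
structure HomologyData (H : ℕ → Type w) [∀ n, AddCommGroup (H n)] [∀ n, Module R (H n)] where
  /-- the class of a cycle -/
  π : ∀ n, X.cycles n →ₗ[R] H n
  π_surjective : ∀ n, Function.Surjective (π n)
  π_eq_zero_iff : ∀ {n : ℕ} (x : X.cycles n),
    π n x = 0 ↔ ∃ y ∈ X.chains False (n + 1), X.d n y = x

namespace HomologyData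

variable {H : ℕ → Type w} [∀ n, AddCommGroup (H n)] [∀ n, Module R (H n)] (D : X.HomologyData H)

lemma π_sh_eq_zero {p q m : ℕ} (h : p + q = m) {x : X.cycles p} (y : X.cycles q)
    (hx : D.π p x = 0) : D.π m (X.shCycles h x y) = 0 := by
  obtain ⟨w, hw, hd⟩ := (D.π_eq_zero_iff x).mp hx
  refine (D.π_eq_zero_iff _).mpr ⟨X.sh (by omega : p + 1 + q = m + 1) w y,
    sh_mem _ hw (chains_le _ _ y.2), ?_⟩
  rw [d_sh h _ w y.2, hd]
  rfl

lemma shCycles_comm {p q m : ℕ} (h : p + q = m) (h' : q + p = m) (x : X.cycles p)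
    (y : X.cycles q) : X.shCycles h x y = ((-1 : ℤ) ^ (p * q)) • X.shCycles h' y x :=
  cycles_ext (by
    rw [AddSubgroupClass.coe_zsmul, phi_zsmul, phi_shCycles, phi_shCycles,
      (isHom_phi _ _).mul_comm (isHom_phi _ _)])

lemma shCycles_add {p q m : ℕ} (h : p + q = m) (x : X.cycles p) (y y' : X.cycles q) :
    X.shCycles h x (y + y') = X.shCycles h x y + X.shCycles h x y' := by
  refine cycles_ext ?_
  simp only [phi_shCycles, Submodule.coe_add, phi_add, mul_add]

lemma add_shCycles {p q m : ℕ} (h : p + q = m) (x x' : X.cycles p) (y : X.cycles q) :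
    X.shCycles h (x + x') y = X.shCycles h x y + X.shCycles h x' y := by
  refine cycles_ext ?_
  simp only [phi_shCycles, Submodule.coe_add, phi_add, add_mul]

lemma shCycles_smul {p q m : ℕ} (h : p + q = m) (r : R) (x : X.cycles p) (y : X.cycles q) :
    X.shCycles h x (r • y) = r • X.shCycles h x y := by
  refine cycles_ext ?_
  simp only [phi_shCycles, Submodule.coe_smul, phi_smul, mul_smul_comm]

lemma smul_shCycles {p q m : ℕ} (h : p + q = m) (r : R) (x : X.cycles p) (y : X.cycles q) :
    X.shCycles h (r • x) y = r • X.shCycles h x y := by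
  refine cycles_ext ?_
  simp only [phi_shCycles, Submodule.coe_smul, phi_smul, smul_mul_assoc]

/-- Boundaries in the second factor are moved to the first by graded commutativity. -/
lemma π_shCycles_congr {p q m : ℕ} (h : p + q = m) {x x' : X.cycles p} {y y' : X.cycles q}
    (hx : D.π p x = D.π p x') (hy : D.π q y = D.π q y') :
    D.π m (X.shCycles h x y) = D.π m (X.shCycles h x' y') := by
  have h1 : D.π m (X.shCycles h (x - x') y) = 0 := D.π_sh_eq_zero h y (by rw [map_sub, hx, sub_self])
  have h2 : D.π m (X.shCycles h x' (y - y')) = 0 := by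
    rw [shCycles_comm h (by omega), map_zsmul,
      D.π_sh_eq_zero _ x' (by rw [map_sub, hy, sub_self]), smul_zero]
  have h3 := add_shCycles h (x - x') x' y
  have h4 := shCycles_add h x' (y - y') y'
  rw [sub_add_cancel] at h3 h4
  rw [h3, h4, map_add, map_add, h1, h2, zero_add, zero_add]

/-- A cycle in a given class. -/
def rep {n : ℕ} (a : H n) : X.cycles n := (D.π_surjective n a).choose

@[simp] lemma π_rep {n : ℕ} (a : H n) : D.π n (D.rep a) = a := (D.π_surjective n a).choose_spec

/-- The product on homology. -/
def mul {p q m : ℕ} (h : p + q = m) : H p →ₗ[R] H q →ₗ[R] H m :=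
  LinearMap.mk₂ R (fun a b => D.π m (X.shCycles h (D.rep a) (D.rep b)))
    (fun a a' b => by
      rw [← map_add, ← add_shCycles]
      exact D.π_shCycles_congr h (by simp) rfl)
    (fun r a b => by
      rw [← map_smul, ← smul_shCycles]
      exact D.π_shCycles_congr h (by simp) rfl)
    (fun a b b' => by
      rw [← map_add, ← shCycles_add]
      exact D.π_shCycles_congr h rfl (by simp))
    (fun r a b => by
      rw [← map_smul, ← shCycles_smul]
      exact D.π_shCycles_congr h rfl (by simp))

lemma mul_π {p q m : ℕ} (h : p + q = m) (x : X.cycles p) (y : X.cycles q) :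
    D.mul h (D.π p x) (D.π q y) = D.π m (X.shCycles h x y) :=
  D.π_shCycles_congr h (D.π_rep _) (D.π_rep _)

variable (X) in
/-- The unit as a cycle. -/
def oneCycle : X.cycles 0 := ⟨1, mem_chains_zero _ _⟩

lemma phi_oneCycle (m : ℕ) : X.phi m (oneCycle X : A 0) = 1 := phi_one m

/-- The graded commutative algebra structure on homology. -/
def algebra : GradedCommAlgebra R H where
  mul := D.mul
  one := D.π 0 (oneCycle X)
  one_mul a := by
    obtain ⟨x, rfl⟩ := D.π_surjective _ a
    rw [mul_π]
    exact congrArg _ (cycles_ext (by rw [phi_shCycles, phi_oneCycle, one_mul]))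
  mul_one a := by
    obtain ⟨x, rfl⟩ := D.π_surjective _ a
    rw [mul_π]
    exact congrArg _ (cycles_ext (by rw [phi_shCycles, phi_oneCycle, mul_one]))
  mul_assoc hpq hqr hs ht a b c := by
    obtain ⟨x, rfl⟩ := D.π_surjective _ a
    obtain ⟨y, rfl⟩ := D.π_surjective _ b
    obtain ⟨z, rfl⟩ := D.π_surjective _ c
    rw [mul_π, mul_π, mul_π, mul_π]
    exact congrArg _ (cycles_ext (by simp only [phi_shCycles, mul_assoc]))
  mul_comm h h' a b := by
    obtain ⟨x, rfl⟩ := D.π_surjective _ a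
    obtain ⟨y, rfl⟩ := D.π_surjective _ b
    rw [mul_π, mul_π, shCycles_comm h h', map_zsmul]

lemma algebra_mul {p q m : ℕ} (h : p + q = m) (x : X.cycles p) (y : X.cycles q) :
    D.algebra.mul h (D.π p x) (D.π q y) = D.π m (X.shCycles h x y) := D.mul_π h x y

lemma exists_pow_eq {p : ℕ} (x : X.cycles p) (i : ℕ) :
    ∃ z : X.cycles (i * p), D.algebra.pow (D.π p x) i = D.π _ z ∧
      ∀ m, X.phi m (z : A (i * p)) = X.phi m (x : A p) ^ i := by
  induction i with
  | zero =>
    -- With `0 * p` replaced by a variable, the transport in `pow` can be eliminated.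
    have : ∀ (n : ℕ) (h : 0 = n), ∃ z : X.cycles n, (h ▸ D.algebra.one : H n) = D.π _ z ∧
        ∀ m, X.phi m (z : A n) = 1 := by
      rintro _ rfl
      exact ⟨oneCycle X, rfl, phi_oneCycle⟩
    obtain ⟨z, h1, h2⟩ := this _ (zero_mul p).symm
    exact ⟨z, h1, fun m => (h2 m).trans (pow_zero _).symm⟩
  | succ i ih =>
    obtain ⟨z, hz, hphi⟩ := ih
    refine ⟨X.shCycles (Nat.succ_mul i p).symm z x, ?_, fun m => ?_⟩
    · rw [GradedCommAlgebra.pow, hz, algebra_mul]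
    · rw [phi_shCycles, hphi, pow_succ]

/-- In even degree, additivity expands the divided power of `x'` plus a boundary; every summand with
a positive divided power of the boundary vanishes in homology. In odd degree only the indices `0`
and `1` matter. -/
lemma π_dpowCycles_congr (i : ℕ) {n m : ℕ} (hn : 0 < n) (h : i * n = m) {x x' : X.cycles n}
    (hx : D.π n x = D.π n x') :
    D.π m (X.dpowCycles i hn h x) = D.π m (X.dpowCycles i hn h x') := by
  rcases Nat.even_or_odd n with he | ho
  · obtain ⟨y, hy, hd⟩ := (D.π_eq_zero_iff (x - x')).mp (by rw [map_sub, hx, sub_self])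
    have hxx : x = x' + (x - x') := by abel
    rw [hxx, dpowCycles_add i hn he h, map_sum,
      Finset.sum_eq_single ⟨(i, 0), by simp⟩]
    · refine congrArg _ (cycles_ext ?_)
      rw [phi_shCycles, phi_dpowCycles, phi_dpowCycles, phi_dpowCycles]
      simp
    · rintro ⟨⟨k, l⟩, hkl⟩ _ hne
      have hl : 0 < l := by
        rcases Nat.eq_zero_or_pos l with rfl | hl
        · refine absurd ?_ hne
          have := Finset.HasAntidiagonal.mem_antidiagonal.mp hkl
          simp only [add_zero] at this
          simp [this]
        · exact hl
      rw [← algebra_mul]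
      have : D.π (l * n) (X.dpowCycles l hn rfl (x - x')) = 0 := by
        rw [D.π_eq_zero_iff]
        obtain ⟨w, hw, hdw⟩ := exists_d_eq_dpow hn hl rfl hy
        refine ⟨w, hw, ?_⟩
        rw [hdw, hd]
        rfl
      rw [this, map_zero]
    · simp
  · match i with
    | 0 =>
      refine congrArg _ (cycles_ext ?_)
      rw [phi_dpowCycles, phi_dpowCycles, dp_zero, dp_zero]
    | 1 =>
      obtain rfl : n = m := by omega
      have : ∀ x : X.cycles n, X.dpowCycles 1 hn h x = x := fun x =>
        cycles_ext (by rw [phi_dpowCycles, dp_one])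
      rw [this, this, hx]
    | i + 2 =>
      refine congrArg _ (cycles_ext ?_)
      rw [phi_dpowCycles, phi_dpowCycles, (isHom_phi m _).dp_eq_zero ho,
        (isHom_phi m _).dp_eq_zero ho]

/-- The divided power operations on homology. -/
def γ (i : ℕ) {n m : ℕ} (hn : 0 < n) (h : i * n = m) (a : H n) : H m :=
  D.π m (X.dpowCycles i hn h (D.rep a))

lemma γ_π (i : ℕ) {n m : ℕ} (hn : 0 < n) (h : i * n = m) (x : X.cycles n) :
    D.γ i hn h (D.π n x) = D.π m (X.dpowCycles i hn h x) :=
  D.π_dpowCycles_congr i hn h (D.π_rep _)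

/-- The system of divided powers on homology. -/
def dividedPowers : GradedDividedPowers D.algebra where
  γ := D.γ
  γ_zero hn a := by
    obtain ⟨x, rfl⟩ := D.π_surjective _ a
    rw [γ_π]
    exact congrArg _ (cycles_ext (by rw [phi_dpowCycles, phi_oneCycle, dp_zero]))
  γ_one hn a := by
    obtain ⟨x, rfl⟩ := D.π_surjective _ a
    rw [γ_π]
    exact congrArg _ (cycles_ext (by rw [phi_dpowCycles, dp_one]))
  γ_odd := by
    intro i n hn a ho hi
    obtain ⟨x, rfl⟩ := D.π_surjective _ a
    obtain ⟨i, rfl⟩ := Nat.exists_eq_add_of_le' hi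
    rw [γ_π, ← map_zero (D.π _)]
    refine congrArg _ (cycles_ext ?_)
    rw [phi_dpowCycles, (isHom_phi _ _).dp_eq_zero ho, Submodule.coe_zero, phi_zero]
  γ_smul i n hn r a := by
    obtain ⟨x, rfl⟩ := D.π_surjective _ a
    rw [← map_smul, γ_π, γ_π, ← map_smul]
    refine congrArg _ (cycles_ext ?_)
    rw [phi_dpowCycles, Submodule.coe_smul, Submodule.coe_smul, phi_smul, phi_smul, phi_dpowCycles,
      (isHom_phi _ _).dp_smul hn, map_pow]
  γ_zero_degree_mul i n hn l a := by
    obtain ⟨x, rfl⟩ := D.π_surjective _ a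
    obtain ⟨y, rfl⟩ := D.π_surjective _ l
    obtain ⟨z, hz, hphi⟩ := D.exists_pow_eq y i
    rw [hz, algebra_mul, γ_π, γ_π, algebra_mul]
    refine congrArg _ (cycles_ext ?_)
    rw [phi_dpowCycles, phi_shCycles, phi_shCycles, phi_dpowCycles, hphi,
      (isHom_phi _ _).dp_mul_eq_pow_mul (isHom_phi _ _) hn]
  γ_mul_γ i j n hn a := by
    obtain ⟨x, rfl⟩ := D.π_surjective _ a
    rw [γ_π, γ_π, γ_π, algebra_mul, ← map_nsmul]
    refine congrArg _ (cycles_ext ?_)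
    rw [phi_shCycles, phi_dpowCycles, phi_dpowCycles, (isHom_phi _ _).dp_mul_dp hn,
      AddSubmonoidClass.coe_nsmul, phi_nsmul, phi_dpowCycles]
  γ_add i n hn he a b := by
    obtain ⟨x, rfl⟩ := D.π_surjective _ a
    obtain ⟨y, rfl⟩ := D.π_surjective _ b
    rw [← map_add, γ_π, dpowCycles_add i hn he, map_sum]
    refine Finset.sum_congr rfl fun k _ => ?_
    rw [γ_π, γ_π, algebra_mul]
  γ_mul_eq_factorial i p q hp hq a b := by
    obtain ⟨x, rfl⟩ := D.π_surjective _ a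
    obtain ⟨y, rfl⟩ := D.π_surjective _ b
    rw [algebra_mul, γ_π, γ_π, γ_π, algebra_mul, ← map_nsmul]
    refine congrArg _ (cycles_ext ?_)
    rw [phi_dpowCycles, phi_shCycles, (isHom_phi _ _).dp_mul (isHom_phi _ _) hp hq,
      AddSubmonoidClass.coe_nsmul, phi_nsmul, phi_shCycles, phi_dpowCycles, phi_dpowCycles]
  γ_mul_eq_pow_mul i p q hp hq a b := by
    obtain ⟨x, rfl⟩ := D.π_surjective _ a
    obtain ⟨y, rfl⟩ := D.π_surjective _ b
    obtain ⟨z, hz, hphi⟩ := D.exists_pow_eq x i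
    rw [hz, algebra_mul, γ_π, γ_π, algebra_mul]
    refine congrArg _ (cycles_ext ?_)
    rw [phi_dpowCycles, phi_shCycles, (isHom_phi _ _).dp_mul_eq_pow_mul (isHom_phi _ _) hq,
      phi_shCycles, phi_dpowCycles, hphi]
  γ_mul_eq_mul_pow i p q hp hq a b := by
    obtain ⟨x, rfl⟩ := D.π_surjective _ a
    obtain ⟨y, rfl⟩ := D.π_surjective _ b
    obtain ⟨z, hz, hphi⟩ := D.exists_pow_eq y i
    rw [hz, algebra_mul, γ_π, γ_π, algebra_mul]
    refine congrArg _ (cycles_ext ?_)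
    rw [phi_dpowCycles, phi_shCycles, (isHom_phi _ _).dp_mul_eq_mul_pow (isHom_phi _ _) hp,
      phi_shCycles, phi_dpowCycles, hphi]
  γ_γ i j n hj hn a := by
    obtain ⟨x, rfl⟩ := D.π_surjective _ a
    rw [γ_π, γ_π, γ_π, ← map_nsmul]
    refine congrArg _ (cycles_ext ?_)
    rw [phi_dpowCycles, phi_dpowCycles, (isHom_phi _ _).dp_dp hn i hj, AddSubmonoidClass.coe_nsmul,
      phi_nsmul, phi_dpowCycles]

end HomologyData

end SimplicialAlgebra

namespace Grassmann

/-! ### Ordered products of monomials -/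

section Products

variable {ι B : Type*} [LinearOrder ι] [CommRing B]

lemma mono_eq_smul (T : Finset ι) (a : B) : mono T a = a • mono T 1 := by
  ext U
  simp only [mono_apply, smul_apply, smul_eq_mul]
  split_ifs <;> simp

lemma mono_mul_mono {T U : Finset ι} (h : Disjoint T U) (a b : B) :
    mono T a * mono U b = (eps T U : B) • mono (T ∪ U) (a * b) := by
  ext W
  rw [mul_apply, smul_apply, mono_apply]
  by_cases hW : W = T ∪ U
  · subst hW
    rw [Finset.sum_eq_single T, Finset.union_sdiff_cancel_left h]
    · simp [mono_apply]
    · intro V _ hV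
      simp [mono_apply, hV]
    · exact fun h' => absurd (Finset.mem_powerset.mpr Finset.subset_union_left) h'
  · rw [if_neg hW, smul_zero]
    refine Finset.sum_eq_zero fun V hV => ?_
    simp only [mono_apply]
    split_ifs with h1 h2
    · exact absurd (by rw [← h2, ← h1, Finset.union_sdiff_of_subset (Finset.mem_powerset.mp hV)]) hW
    all_goals simp

lemma mono_mul_mono_of_not_disjoint {T U : Finset ι} (h : ¬Disjoint T U) (a b : B) :
    mono T a * mono U b = 0 := by
  ext W
  rw [mul_apply]
  refine Finset.sum_eq_zero fun V hV => ?_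
  simp only [mono_apply]
  split_ifs with h1 h2
  · exact absurd (by rw [← h2, ← h1]; exact Finset.disjoint_sdiff) h
  all_goals simp

lemma prod_ofFn_mono_singleton {k : ℕ} {e : Fin k → ι} (he : StrictMono e) :
    (List.ofFn fun t => mono {e t} (1 : B)).prod = mono (Finset.univ.image e) 1 := by
  induction k with
  | zero => rfl
  | succ k ih =>
    have hlt : ∀ t : Fin k, e 0 < e t.succ := fun t => he (Fin.succ_pos t)
    have hd : Disjoint {e 0} (Finset.univ.image fun t : Fin k => e t.succ) := by
      rw [Finset.disjoint_singleton_left, Finset.mem_image]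
      rintro ⟨t, _, ht⟩
      exact (hlt t).ne' ht
    have heps : eps {e 0} (Finset.univ.image fun t : Fin k => e t.succ) = 1 := by
      rw [eps, Finset.prod_singleton]
      refine Finset.prod_eq_one fun u hu => ?_
      obtain ⟨t, _, rfl⟩ := Finset.mem_image.mp hu
      rw [if_neg (hlt t).not_gt]
    rw [List.ofFn_succ, List.prod_cons,
      ih (e := fun t => e t.succ) (he.comp Fin.strictMono_succ),
      mono_mul_mono hd, heps]
    have : Finset.univ.image e = {e 0} ∪ Finset.univ.image fun t : Fin k => e t.succ := by
      ext x
      simp [Fin.exists_fin_succ, eq_comm]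
    rw [this]
    simp

lemma prod_ofFn_smul {k : ℕ} (a : Fin k → B) (z : Fin k → Grassmann ι B) :
    (List.ofFn fun j => a j • z j).prod = (∏ j, a j) • (List.ofFn z).prod := by
  induction k with
  | zero => simp
  | succ k ih =>
    rw [List.ofFn_succ, List.prod_cons, ih (fun j => a j.succ) (fun j => z j.succ),
      List.ofFn_succ, List.prod_cons, Fin.prod_univ_succ, smul_mul_smul_comm]

/-- Elements of degree one have square zero, so the universal exterior algebra maps to this one, and
the sign comes from the alternating map `ιMulti`. -/
lemma prod_ofFn_mono_perm {m : ℕ} (σ : Equiv.Perm (Fin m)) :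
    (List.ofFn fun t => mono {σ t} (1 : B)).prod =
      ((Equiv.Perm.sign σ : ℤˣ) : ℤ) • mono Finset.univ (1 : B) := by
  let f : (Fin m → B) →ₗ[B] Grassmann (Fin m) B :=
    ∑ s, (LinearMap.proj s).smulRight (mono {s} (1 : B))
  have hf1 : ∀ v : Fin m → B, IsHom 1 (f v) := fun v T hT => by
    by_contra h
    refine hT ?_
    simp only [f, LinearMap.sum_apply, LinearMap.smulRight_apply, sum_apply, smul_apply]
    refine Finset.sum_eq_zero fun s _ => ?_
    rw [mono_apply, if_neg (fun h' => h (by rw [h', Finset.card_singleton])), smul_zero]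
  have hf2 : ∀ s, f (Pi.single s 1) = mono {s} 1 := fun s => by
    simp only [f, LinearMap.sum_apply, LinearMap.smulRight_apply, LinearMap.proj_apply]
    rw [Finset.sum_eq_single s]
    · simp
    · intro t _ ht
      simp [ht]
    · simp
  let F := ExteriorAlgebra.lift B ⟨f, fun v => (hf1 v).mul_self odd_one⟩
  have hF : ∀ v : Fin m → Fin m → B,
      F (ExteriorAlgebra.ιMulti B m v) = (List.ofFn fun t => f (v t)).prod := fun v => by
    rw [ExteriorAlgebra.ιMulti_apply, map_list_prod, List.map_ofFn]
    congr 2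
    funext t
    exact ExteriorAlgebra.lift_ι_apply B f _ _
  have h := congrArg F ((ExteriorAlgebra.ιMulti B m).map_perm (fun s => Pi.single s (1 : B)) σ)
  rw [hF] at h
  rw [Units.smul_def, map_zsmul, hF] at h
  simp only [Function.comp_apply, hf2] at h
  have hid := prod_ofFn_mono_singleton (B := B) (strictMono_id (α := Fin m))
  rw [Finset.image_id] at hid
  rw [h, ← hid]
  rfl

end Products

end Grassmann

open Grassmann

/-! ### Shuffles -/

lemma mem_shuffles {p q : ℕ} {σ : Equiv.Perm (Fin (p + q))} : σ ∈ shuffles p q ↔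
    StrictMono (fun t : Fin p => σ (Fin.castAdd q t)) ∧
      StrictMono (fun t : Fin q => σ (Fin.natAdd p t)) := by
  simp [shuffles]

lemma firstBlock_eq_image {p q : ℕ} (σ : Equiv.Perm (Fin (p + q))) :
    firstBlock σ = Finset.univ.image fun t : Fin p => σ (Fin.castAdd q t) := by
  ext
  simp [firstBlock]

lemma secondBlock_eq_image {p q : ℕ} (σ : Equiv.Perm (Fin (p + q))) :
    secondBlock σ = Finset.univ.image fun t : Fin q => σ (Fin.natAdd p t) := by
  ext
  simp [secondBlock]

lemma secondBlock_eq_compl {p q : ℕ} (σ : Equiv.Perm (Fin (p + q))) :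
    secondBlock σ = Finset.univ \ firstBlock σ := by
  ext x
  obtain ⟨t, rfl⟩ := σ.surjective x
  refine Fin.addCases (fun t => ?_) (fun t => ?_) t
  · simp only [secondBlock, firstBlock, Finset.mem_map, Finset.mem_sdiff, Finset.mem_univ,
      true_and, Function.Embedding.trans_apply, Equiv.coe_toEmbedding, EmbeddingLike.apply_eq_iff_eq,
      Fin.natAddEmb_apply, Fin.castAddEmb_apply]
    constructor
    · rintro ⟨s, hs⟩
      have := congrArg Fin.val hs
      simp at this
      omega
    · intro h
      exact absurd ⟨t, rfl⟩ h
  · simp only [secondBlock, firstBlock, Finset.mem_map, Finset.mem_sdiff, Finset.mem_univ,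
      true_and, Function.Embedding.trans_apply, Equiv.coe_toEmbedding, EmbeddingLike.apply_eq_iff_eq,
      Fin.natAddEmb_apply, Fin.castAddEmb_apply]
    constructor
    · rintro _ ⟨s, hs⟩
      have := congrArg Fin.val hs
      simp at this
      omega
    · intro _
      exact ⟨t, rfl⟩

/-- The product of the basis vectors in the order given by `σ` splits into two increasing products,
which are the monomials of the two blocks. -/
lemma eps_firstBlock_secondBlock {p q : ℕ} {σ : Equiv.Perm (Fin (p + q))} (hσ : σ ∈ shuffles p q) :
    eps (firstBlock σ) (secondBlock σ) = ((Equiv.Perm.sign σ : ℤˣ) : ℤ) := by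
  have h := prod_ofFn_mono_perm (B := ℤ) σ
  have h1 := prod_ofFn_mono_singleton (B := ℤ) (mem_shuffles.mp hσ).1
  have h2 := prod_ofFn_mono_singleton (B := ℤ) (mem_shuffles.mp hσ).2
  have hd : Disjoint (firstBlock σ) (secondBlock σ) := by
    rw [secondBlock_eq_compl]
    exact Finset.disjoint_sdiff
  have hu : firstBlock σ ∪ secondBlock σ = Finset.univ := by
    rw [secondBlock_eq_compl]
    exact Finset.union_sdiff_of_subset (Finset.subset_univ _)
  rw [← firstBlock_eq_image] at h1
  rw [← secondBlock_eq_image] at h2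
  rw [List.ofFn_add, List.prod_append] at h
  have h3 := (congrArg₂ (· * ·) h1.symm h2.symm).trans h
  rw [mono_mul_mono hd, hu] at h3
  have h4 := congrFun h3 Finset.univ
  rw [Grassmann.smul_apply, zsmul_apply, mono_apply, if_pos rfl, mono_apply, if_pos rfl] at h4
  simpa using h4

lemma firstBlock_injOn {p q : ℕ} : Set.InjOn (firstBlock (p := p) (q := q)) (shuffles p q) := by
  intro σ hσ τ hτ h
  have hσ' := mem_shuffles.mp hσ
  have hτ' := mem_shuffles.mp hτ
  have h1 : (fun t : Fin p => σ (Fin.castAdd q t)) = fun t => τ (Fin.castAdd q t) := by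
    refine (hσ'.1.range_inj hτ'.1).mp ?_
    have := congrArg (fun T : Finset _ => (T : Set (Fin (p + q)))) h
    simpa [firstBlock_eq_image] using this
  have h2 : (fun t : Fin q => σ (Fin.natAdd p t)) = fun t => τ (Fin.natAdd p t) := by
    refine (hσ'.2.range_inj hτ'.2).mp ?_
    have h' : secondBlock σ = secondBlock τ := by rw [secondBlock_eq_compl, h, secondBlock_eq_compl]
    have := congrArg (fun T : Finset _ => (T : Set (Fin (p + q)))) h'
    simpa [secondBlock_eq_image] using this
  ext t
  refine congrArg Fin.val ?_
  refine Fin.addCases (fun t => congrFun h1 t) (fun t => congrFun h2 t) t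

lemma exists_firstBlock_eq {p q : ℕ} (T : Finset (Fin (p + q))) (hT : T.card = p) :
    ∃ σ ∈ shuffles p q, firstBlock σ = T := by
  have hT' : Tᶜ.card = q := by rw [Finset.card_compl, hT, Fintype.card_fin]; omega
  let σ : Equiv.Perm (Fin (p + q)) := finSumFinEquiv.symm.trans (finSumEquivOfFinset hT hT')
  have h1 : ∀ t : Fin p, σ (Fin.castAdd q t) = T.orderEmbOfFin hT t := fun t => by
    simp [σ]
  have h2 : ∀ t : Fin q, σ (Fin.natAdd p t) = Tᶜ.orderEmbOfFin hT' t := fun t => by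
    simp [σ]
  refine ⟨σ, mem_shuffles.mpr ⟨?_, ?_⟩, ?_⟩
  · simp only [h1]
    exact (T.orderEmbOfFin hT).strictMono
  · simp only [h2]
    exact (Tᶜ.orderEmbOfFin hT').strictMono
  · rw [firstBlock_eq_image]
    simp only [h1]
    exact Finset.image_orderEmbOfFin_univ T hT

/-! ### The shuffle product as a sum over shuffles -/

namespace SimplicialAlgebra

variable {R : Type u} [CommRing R] {A : ℕ → Type v} [∀ n, CommRing (A n)] [∀ n, Algebra R (A n)]
  (X : SimplicialAlgebra R A)

lemma sh_eq_sum {p q : ℕ} (x : A p) (y : A q) : X.sh rfl x y =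
    ∑ σ ∈ shuffles p q, ((Equiv.Perm.sign σ : ℤˣ) : ℤ) •
      (X.map (stepMap (firstBlock σ) (card_firstBlock σ)) x *
        X.map (stepMap (secondBlock σ) (card_secondBlock σ)) y) := by
  rw [sh, Grassmann.mul_apply]
  have h1 : ∀ σ ∈ shuffles p q, ((Equiv.Perm.sign σ : ℤˣ) : ℤ) •
      (X.map (stepMap (firstBlock σ) (card_firstBlock σ)) x *
        X.map (stepMap (secondBlock σ) (card_secondBlock σ)) y) =
      (eps (firstBlock σ) (Finset.univ \ firstBlock σ) : A (p + q)) *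
        (X.phi (p + q) x (firstBlock σ) * X.phi (p + q) y (Finset.univ \ firstBlock σ)) := by
    intro σ hσ
    rw [← secondBlock_eq_compl, eps_firstBlock_secondBlock hσ, phi_apply x (card_firstBlock σ),
      phi_apply y (card_secondBlock σ), zsmul_eq_mul]
  rw [Finset.sum_congr rfl h1, ← Finset.sum_image (s := shuffles p q) (g := firstBlock)
    (f := fun T => (eps T (Finset.univ \ T) : A (p + q)) *
      (X.phi (p + q) x T * X.phi (p + q) y (Finset.univ \ T))) firstBlock_injOn]
  refine (Finset.sum_subset (fun _ _ => by simp) fun T _ hT => ?_).symm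
  have : T.card ≠ p := fun h => hT (by
    obtain ⟨σ, hσ, rfl⟩ := exists_firstBlock_eq T h
    exact Finset.mem_image_of_mem _ hσ)
  rw [phi, dif_neg this, zero_mul, mul_zero]

end SimplicialAlgebra

/-! ### Block shuffles -/

section Blocks

variable {i n : ℕ}

lemma mem_blockShuffles {hn : 0 < n} {σ : Equiv.Perm (Fin (i * n))} : σ ∈ blockShuffles i n hn ↔
    (∀ j : Fin i, StrictMono fun t : Fin n => σ (finProdFinEquiv (j, t))) ∧
      StrictMono fun j : Fin i => σ (finProdFinEquiv (j, ⟨0, hn⟩)) := by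
  simp [blockShuffles]

lemma block_eq_image (σ : Equiv.Perm (Fin (i * n))) (j : Fin i) :
    block σ j = Finset.univ.image fun t : Fin n => σ (finProdFinEquiv (j, t)) := by
  ext
  simp only [block, Finset.mem_map, Finset.mem_image]
  rfl

lemma disjoint_block (σ : Equiv.Perm (Fin (i * n))) {j k : Fin i} (h : j ≠ k) :
    Disjoint (block σ j) (block σ k) := by
  rw [Finset.disjoint_left]
  intro x hj hk
  rw [block_eq_image, Finset.mem_image] at hj hk
  obtain ⟨t, _, rfl⟩ := hj
  obtain ⟨t', _, h'⟩ := hk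
  have := finProdFinEquiv.injective (σ.injective h')
  exact h (congrArg Prod.fst this).symm

lemma block_injective (hn : 0 < n) (σ : Equiv.Perm (Fin (i * n))) :
    Function.Injective (block σ) := by
  intro j k h
  by_contra hne
  have := disjoint_block σ hne
  rw [h, disjoint_self, Finset.bot_eq_empty] at this
  have hc := card_block σ k
  rw [this, Finset.card_empty] at hc
  omega

lemma prod_ofFn_mono_block {B : Type*} [CommRing B] {hn : 0 < n} {σ : Equiv.Perm (Fin (i * n))}
    (hσ : σ ∈ blockShuffles i n hn) : (List.ofFn fun j => mono (block σ j) (1 : B)).prod =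
      ((Equiv.Perm.sign σ : ℤˣ) : ℤ) • mono Finset.univ (1 : B) := by
  rw [← prod_ofFn_mono_perm, List.ofFn_mul, List.prod_flatten, List.map_ofFn]
  congr 2
  funext j
  rw [block_eq_image, ← prod_ofFn_mono_singleton ((mem_blockShuffles.mp hσ).1 j)]
  rw [Function.comp_apply]
  congr 2
  funext t
  congr 3
  refine Fin.ext ?_
  rw [finProdFinEquiv_apply_val]
  ring

/-- The set of blocks of a permutation. -/
def blocks (σ : Equiv.Perm (Fin (i * n))) : Finset (Finset (Fin (i * n))) :=
  Finset.univ.image (block σ)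

/-- The partition determines the set of first elements; both permutations list it increasingly, so
corresponding blocks have the same index. -/
lemma blocks_injOn (hn : 0 < n) : Set.InjOn (blocks (i := i) (n := n)) (blockShuffles i n hn) := by
  have key : ∀ {σ τ : Equiv.Perm (Fin (i * n))}, σ ∈ blockShuffles i n hn →
      τ ∈ blockShuffles i n hn → blocks σ = blocks τ → ∀ j, ∃ k,
        ∀ t, σ (finProdFinEquiv (j, t)) = τ (finProdFinEquiv (k, t)) := by
    intro σ τ hσ hτ h j
    have hmem : block σ j ∈ blocks τ := by
      rw [← h]
      exact Finset.mem_image_of_mem _ (Finset.mem_univ j)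
    obtain ⟨k, _, hk⟩ := Finset.mem_image.mp hmem
    refine ⟨k, fun t => congrFun ((((mem_blockShuffles.mp hσ).1 j).range_inj
      ((mem_blockShuffles.mp hτ).1 k)).mp ?_) t⟩
    have := congrArg (fun T : Finset _ => (T : Set (Fin (i * n)))) hk.symm
    simpa [block_eq_image] using this
  intro σ hσ τ hτ h
  have h0 : (fun j : Fin i => σ (finProdFinEquiv (j, ⟨0, hn⟩))) =
      fun j => τ (finProdFinEquiv (j, ⟨0, hn⟩)) := by
    refine ((mem_blockShuffles.mp hσ).2.range_inj (mem_blockShuffles.mp hτ).2).mp ?_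
    refine Set.Subset.antisymm ?_ ?_
    · rintro _ ⟨j, rfl⟩
      obtain ⟨k, hk⟩ := key hσ hτ h j
      exact ⟨k, (hk _).symm⟩
    · rintro _ ⟨j, rfl⟩
      obtain ⟨k, hk⟩ := key hτ hσ h.symm j
      exact ⟨k, (hk _).symm⟩
  ext x
  refine congrArg Fin.val ?_
  obtain ⟨⟨j, t⟩, rfl⟩ := finProdFinEquiv.surjective x
  obtain ⟨k, hk⟩ := key hσ hτ h j
  have h1 := (congrFun h0 j).symm.trans (hk ⟨0, hn⟩)
  have h2 := congrArg Prod.fst (finProdFinEquiv.injective (τ.injective h1))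
  simp only at h2
  rw [hk, h2]

lemma exists_blocks_eq (hn : 0 < n) {S : Finset (Finset (Fin (i * n)))} (hS : S.card = i)
    (hcard : ∀ T ∈ S, T.card = n) (hdisj : ∀ T ∈ S, ∀ U ∈ S, T ≠ U → Disjoint T U) :
    ∃ σ ∈ blockShuffles i n hn, blocks σ = S := by
  have hne : ∀ T ∈ S, T.Nonempty := fun T hT => Finset.card_pos.mp (by rw [hcard T hT]; exact hn)
  -- The parts are ordered by their minima, and each is enumerated increasingly.
  let M : {T // T ∈ S} → Fin (i * n) := fun T => T.1.min' (hne T.1 T.2)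
  have hM : Function.Injective M := by
    intro T U h
    by_contra hTU
    have := hdisj T.1 T.2 U.1 U.2 fun h => hTU (Subtype.ext h)
    exact Finset.disjoint_left.mp this (Finset.min'_mem _ (hne T.1 T.2))
      ((congrArg (· ∈ U.1) h).mpr (Finset.min'_mem _ (hne U.1 U.2)))
  have hMc : (S.attach.image M).card = i := by
    rw [Finset.card_image_of_injective _ hM, Finset.card_attach, hS]
  obtain ⟨e, he⟩ : ∃ e : Fin i ↪o Fin (i * n), ∀ j, ∃ T : {T // T ∈ S}, M T = e j := by
    refine ⟨(S.attach.image M).orderEmbOfFin hMc, fun j => ?_⟩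
    have := Finset.orderEmbOfFin_mem (S.attach.image M) hMc j
    obtain ⟨T, _, hT⟩ := Finset.mem_image.mp this
    exact ⟨T, hT⟩
  choose T hT using he
  have hTinj : Function.Injective T := fun j k h => e.injective (by rw [← hT, h, hT])
  let g : Fin i × Fin n → Fin (i * n) := fun x => (T x.1).1.orderEmbOfFin (hcard _ (T x.1).2) x.2
  have hg : ∀ x, g x ∈ (T x.1).1 := fun x => Finset.orderEmbOfFin_mem _ _ _
  have hginj : Function.Injective g := by
    rintro ⟨j, t⟩ ⟨k, t'⟩ h
    have hjk : j = k := by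
      by_contra hjk
      have := hdisj _ (T j).2 _ (T k).2 fun h => hjk (hTinj (Subtype.ext h))
      refine Finset.disjoint_left.mp this (hg (j, t)) ?_
      rw [h]
      exact hg (k, t')
    subst hjk
    have := ((T j).1.orderEmbOfFin (hcard _ (T j).2)).injective h
    exact congrArg (Prod.mk j) this
  -- Disjointness gives injectivity; counting shows that the parts cover everything.
  have hbij : Function.Bijective fun x => g (finProdFinEquiv.symm x) :=
    Finite.injective_iff_bijective.mp (hginj.comp finProdFinEquiv.symm.injective)
  obtain ⟨σ, hσ⟩ : ∃ σ : Equiv.Perm (Fin (i * n)), ∀ x, σ (finProdFinEquiv x) = g x := by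
    refine ⟨Equiv.ofBijective _ hbij, fun x => ?_⟩
    rw [Equiv.ofBijective_apply, Equiv.symm_apply_apply]
  refine ⟨σ, mem_blockShuffles.mpr ⟨fun j => ?_, ?_⟩, ?_⟩
  · simp only [hσ]
    exact ((T j).1.orderEmbOfFin (hcard _ (T j).2)).strictMono
  · have : ∀ j, σ (finProdFinEquiv (j, ⟨0, hn⟩)) = e j := fun j =>
      (hσ _).trans ((Finset.orderEmbOfFin_zero (hcard _ (T j).2) hn).trans (hT j))
    simp only [this]
    exact e.strictMono
  · have hb : ∀ j, block σ j = (T j).1 := fun j => by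
      rw [block_eq_image]
      refine Eq.trans ?_ (Finset.image_orderEmbOfFin_univ (T j).1 (hcard _ (T j).2))
      exact congrArg (Finset.image · Finset.univ) (funext fun t => hσ (j, t))
    have hsub : blocks σ ⊆ S := by
      intro U hU
      obtain ⟨j, _, rfl⟩ := Finset.mem_image.mp hU
      rw [hb]
      exact (T j).2
    refine Finset.eq_of_subset_of_card_le hsub ?_
    rw [blocks, Finset.card_image_of_injective _ (block_injective hn σ), hS]
    simp

end Blocks

/-! ### Divided powers as sums over block shuffles -/

namespace SimplicialAlgebra

variable {R : Type u} [CommRing R] {A : ℕ → Type v} [∀ n, CommRing (A n)] [∀ n, Algebra R (A n)]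
  (X : SimplicialAlgebra R A)

lemma term_phi {m n : ℕ} (hn : 0 < n) (he : Even n) (x : A n) {T : Finset (Fin m)}
    (hT : T.card = n) :
    (term (X.phi m x) T : Grassmann (Fin m) (A m)) = mono T (X.map (stepMap T hT) x) := by
  rw [term, dif_pos ⟨hT ▸ he, Finset.card_pos.mp (hT ▸ hn)⟩]
  exact congrArg (mono T) (phi_apply x hT)

lemma term_phi_eq_zero {m n : ℕ} (x : A n) {T : Finset (Fin m)}
    (hT : T.card ≠ n) : term (X.phi m x) T = 0 := by
  rw [term]
  split_ifs with h
  · have h0 : X.phi m x T = 0 := dif_neg hT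
    refine Subtype.ext ?_
    ext U
    simp [mono_apply, h0]
  · rfl

/-- A product of `i` distinct monomials of `phi` is nonzero only if their sets are disjoint
`n`-sets, which then partition the steps; such partitions are the `blocks` of unique block shuffles.
-/
lemma dpow_eq_sum (i : ℕ) {n : ℕ} (hn : 0 < n) (he : Even n) (x : A n) : X.dpow i rfl x =
    ∑ σ ∈ blockShuffles i n hn, ((Equiv.Perm.sign σ : ℤˣ) : ℤ) •
      (List.ofFn fun j : Fin i => X.map (stepMap (block σ j) (card_block σ j)) x).prod := by
  rw [dpow, ← (isHom_phi _ x).esymm_eq_dp he hn, esymm, Grassmann.sum_apply]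
  set z := X.phi (i * n) x with hz
  have h1 : ∀ σ ∈ blockShuffles i n hn, ((Equiv.Perm.sign σ : ℤˣ) : ℤ) •
      (List.ofFn fun j : Fin i => X.map (stepMap (block σ j) (card_block σ j)) x).prod =
      ((∏ T ∈ blocks σ, term z T : Subring.center (Grassmann (Fin (i * n)) (A (i * n)))) :
        Grassmann (Fin (i * n)) (A (i * n))) Finset.univ := by
    intro σ hσ
    rw [blocks, Finset.prod_image fun j _ k _ h => block_injective hn σ h, ← List.prod_ofFn,
      SubmonoidClass.coe_list_prod, List.map_ofFn]
    have h2 : (List.ofFn (Subtype.val ∘ fun j => term z (block σ j))).prod =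
        (List.ofFn fun j : Fin i => X.map (stepMap (block σ j) (card_block σ j)) x •
          mono (block σ j) (1 : A (i * n))).prod := by
      congr 2
      funext j
      rw [← mono_eq_smul, ← X.term_phi hn he x (card_block σ j)]
      rfl
    rw [h2, prod_ofFn_smul, prod_ofFn_mono_block hσ, List.prod_ofFn, Grassmann.smul_apply,
      zsmul_apply, mono_apply, if_pos rfl, smul_comm, smul_eq_mul, mul_one]
  rw [Finset.sum_congr rfl h1, ← Finset.sum_image (s := blockShuffles i n hn) (g := blocks)
    (f := fun S => ((∏ T ∈ S, term z T : Subring.center (Grassmann (Fin (i * n)) (A (i * n)))) :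
        Grassmann (Fin (i * n)) (A (i * n))) Finset.univ) (blocks_injOn hn)]
  refine (Finset.sum_subset (fun S hS => ?_) fun S hS hS' => ?_).symm
  · obtain ⟨σ, _, rfl⟩ := Finset.mem_image.mp hS
    rw [Finset.mem_powersetCard]
    refine ⟨Finset.subset_univ _, ?_⟩
    rw [blocks, Finset.card_image_of_injective _ (block_injective hn σ)]
    simp
  · suffices h : ∏ T ∈ S, term z T = 0 by
      rw [h]
      rfl
    by_contra h
    have hcard : ∀ T ∈ S, T.card = n := fun T hT => by
      by_contra hT'
      exact h (Finset.prod_eq_zero hT (X.term_phi_eq_zero x hT'))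
    have hdisj : ∀ T ∈ S, ∀ U ∈ S, T ≠ U → Disjoint T U := fun T hT U hU hTU => by
      by_contra hd
      refine h ?_
      rw [← Finset.mul_prod_erase _ _ hT,
        ← Finset.mul_prod_erase (S.erase T) _ (Finset.mem_erase.mpr ⟨hTU.symm, hU⟩), ← mul_assoc]
      have : term z T * term z U = 0 := by
        refine Subtype.ext ?_
        rw [Subring.coe_mul, X.term_phi hn he x (hcard T hT), X.term_phi hn he x (hcard U hU)]
        exact mono_mul_mono_of_not_disjoint hd _ _
      rw [this, zero_mul]
    obtain ⟨σ, hσ, hσS⟩ := exists_blocks_eq hn (Finset.mem_powersetCard.mp hS).2 hcard hdisj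
    exact hS' (Finset.mem_image.mpr ⟨σ, hσ, hσS⟩)

end SimplicialAlgebra

/-! ### The simplicial commutative algebra of a commutative monoid -/

section Glue

open CategoryTheory.Limits AlgebraicTopology MonObj

variable {R : Type u} [CommRing R]

/-- The functor `Γ`, as a monoidal functor for the transported structure. -/
abbrev gammaFunctor (R : Type u) [CommRing R] : LargeCh R ⥤ SMod R :=
    (Monoidal.equivalenceTransported (doldKan R)).inverse

/-- `Γ` is a monoidal functor for the transported structure; the multiplication it induces is
`gammaMul` by definition. -/
lemma gammaMul_assoc (C : LargeCh R) [MonObj C] :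
    gammaMul C ▷ gamma C ≫ gammaMul C = (α_ (gamma C) (gamma C) (gamma C)).hom ≫
      gamma C ◁ gammaMul C ≫ gammaMul C :=
  letI := Functor.monObjObj (F := gammaFunctor R) C
  MonObj.mul_assoc ((gammaFunctor R).obj C)

lemma one_gammaMul (C : LargeCh R) [MonObj C] :
    gammaOne C ▷ gamma C ≫ gammaMul C = (λ_ (gamma C)).hom :=
  letI := Functor.monObjObj (F := gammaFunctor R) C
  MonObj.one_mul ((gammaFunctor R).obj C)

lemma gammaMul_comm (C : LargeCh R) [MonObj C] [IsCommMonObj C] :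
    (β_ (gamma C) (gamma C)).hom ≫ gammaMul C = gammaMul C :=
  letI := Functor.monObjObj (F := gammaFunctor R) C
  IsCommMonObj.mul_comm ((gammaFunctor R).obj C)

/-- The multiplication of `(Γ C)_m` as a bilinear map. -/
def gammaMulLevel (C : LargeCh R) [MonObj C] (m : ℕ) : (gamma C).obj (op ⦋m⦌) →ₗ[R]
    (gamma C).obj (op ⦋m⦌) →ₗ[R] (gamma C).obj (op ⦋m⦌) :=
  TensorProduct.curry ((gammaMul C).app (op ⦋m⦌)).hom

lemma gammaMulLevel_assoc (C : LargeCh R) [MonObj C] (m : ℕ) (x y z : (gamma C).obj (op ⦋m⦌)) :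
    gammaMulLevel C m (gammaMulLevel C m x y) z = gammaMulLevel C m x (gammaMulLevel C m y z) := by
  have := congrArg (fun f => (f.app (op ⦋m⦌)).hom ((x ⊗ₜ[R] y) ⊗ₜ[R] z)) (gammaMul_assoc C)
  exact this

lemma gammaMulLevel_comm (C : LargeCh R) [MonObj C] [IsCommMonObj C] (m : ℕ)
    (x y : (gamma C).obj (op ⦋m⦌)) :
    gammaMulLevel C m x y = gammaMulLevel C m y x := by
  have := congrArg (fun f => (f.app (op ⦋m⦌)).hom (y ⊗ₜ[R] x)) (gammaMul_comm C)
  exact this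

lemma gammaMulLevel_one (C : LargeCh R) [MonObj C] (m : ℕ) (x : (gamma C).obj (op ⦋m⦌)) :
    gammaMulLevel C m (((gammaOne C).app (op ⦋m⦌)).hom (1 : R)) x = x := by
  have := congrArg (fun f => (f.app (op ⦋m⦌)).hom ((1 : R) ⊗ₜ[R] x)) (one_gammaMul C)
  refine this.trans ?_
  exact one_smul R x

lemma gammaMulLevel_map (C : LargeCh R) [MonObj C] {m k : ℕ} (f : ⦋k⦌ ⟶ ⦋m⦌)
    (x y : (gamma C).obj (op ⦋m⦌)) :
    (gamma C).map f.op (gammaMulLevel C m x y) =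
      gammaMulLevel C k ((gamma C).map f.op x) ((gamma C).map f.op y) := by
  have := congrArg (fun f => f.hom (x ⊗ₜ[R] y)) ((gammaMul C).naturality f.op)
  exact this.symm

lemma gammaOne_map (C : LargeCh R) [MonObj C] {m k : ℕ} (f : ⦋k⦌ ⟶ ⦋m⦌) :
    (gamma C).map f.op (((gammaOne C).app (op ⦋m⦌)).hom (1 : R)) =
      (((gammaOne C).app (op ⦋k⦌)).hom (1 : R)) := by
  have := congrArg (fun f => f.hom (1 : R)) ((gammaOne C).naturality f.op)
  exact this.symm

/-! ### Normalized chains and homology in terms of elements -/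

lemma incl_eq (A : SMod R) (n : ℕ) : incl A n = (NormalizedMooreComplex.objX A n).arrow.hom := rfl

lemma incl_injective (A : SMod R) (n : ℕ) : Function.Injective (incl A n) := by
  rw [incl_eq]
  exact (ModuleCat.mono_iff_injective _).1 inferInstance

lemma incl_d (A : SMod R) (n : ℕ) (w : (normalized A).X (n + 1)) :
    incl A n (((normalized A).d (n + 1) n).hom w) =
      (A.map (SimplexCategory.δ (0 : Fin (n + 2))).op).hom (incl A (n + 1) w) := by
  have h : ((normalized A).d (n + 1) n) ≫ (NormalizedMooreComplex.objX A n).arrow =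
    (NormalizedMooreComplex.objX A (n + 1)).arrow ≫
      A.map (SimplexCategory.δ (0 : Fin (n + 2))).op := by
    have := normalizedMooreComplex_objD A n
    erw [this]
    cases n with
    | zero =>
      have key : ∀ {X Y Z : ModuleCat.{u} R} (a : X ⟶ Y) (b : Y ⟶ Z) {Z' : ModuleCat.{u} R}
        (t : Z' ⟶ Z) [IsIso t],
          (a ≫ b ≫ inv t) ≫ t = a ≫ b := by intros; simp
      exact key _ _ (⊤ : Subobject (A.obj (op ⦋0⦌))).arrow
    | succ n =>
      rw [NormalizedMooreComplex.objD]
      apply Subobject.factorThru_arrow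
  exact congrArg (fun f => f.hom w) h

lemma incl_face (A : SMod R) (n : ℕ) (w : (normalized A).X (n + 1)) (j : Fin (n + 1)) :
    (A.map (SimplexCategory.δ j.succ).op).hom (incl A (n + 1) w) = 0 := by
  have h : (NormalizedMooreComplex.objX A (n + 1)).arrow ≫ A.map (SimplexCategory.δ j.succ).op =
    0 := by
    have := Subobject.finset_inf_arrow_factors Finset.univ
      (fun k : Fin (n + 1) => kernelSubobject (SimplicialObject.δ A k.succ)) j (by simp)
    have h2 := Subobject.factorThru_arrow _ _ this
    change (Finset.univ.inf fun k : Fin (n + 1) =>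
      kernelSubobject (SimplicialObject.δ A k.succ)).arrow ≫ SimplicialObject.δ A j.succ = 0
    rw [← h2, Category.assoc, kernelSubobject_arrow_comp, comp_zero]
  exact congrArg (fun f => f.hom w) h

lemma exists_incl (A : SMod R) (n : ℕ) (x : A.obj (op ⦋n + 1⦌))
    (h : ∀ j : Fin (n + 1), (A.map (SimplexCategory.δ j.succ).op).hom x = 0) : ∃ w,
      incl A (n + 1) w = x := by
  let f : ModuleCat.of R R ⟶ A.obj (op ⦋n + 1⦌) := ModuleCat.ofHom (LinearMap.toSpanSingleton R _ x)
  have hf : (NormalizedMooreComplex.objX A (n + 1)).Factors f := by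
    rw [NormalizedMooreComplex.objX_add_one]
    rw [Subobject.finset_inf_factors]
    intro j _
    apply kernelSubobject_factors
    ext
    simp [f]
    exact h j
  refine ⟨(Subobject.factorThru _ f hf).hom (1 : R), ?_⟩
  have := congrArg (fun g => g.hom (1 : R)) (Subobject.factorThru_arrow _ _ hf)
  refine this.trans ?_
  simp [f]

lemma exists_incl_zero (A : SMod R) (x : A.obj (op ⦋0⦌)) : ∃ w, incl A 0 w = x := by
  have := (ModuleCat.epi_iff_surjective (NormalizedMooreComplex.objX A 0).arrow).1
    (by dsimp; infer_instance)
  exact this x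

lemma incl_naturality {A B : SMod R} (f : A ⟶ B) (n : ℕ) (w : (normalized A).X n) :
    incl B n ((((doldKan R).functor.map f).f n).hom w) = (f.app (op ⦋n⦌)).hom (incl A n w) := by
  have := congrArg (fun g => (g.f n).hom w)
    ((AlgebraicTopology.inclusionOfMooreComplex (ModuleCat.{u} R)).naturality f)
  exact this

/-- Naturality of the inverse counit, combined with a triangle identity. -/
lemma comp_counitInv_app {C D : Type*} [Category* C] [Category* D] (e : C ≌ D) {X : C} {Y : D}
    (f : e.functor.obj X ⟶ Y) :
    f ≫ e.counitIso.inv.app Y = e.functor.map (e.unitIso.hom.app X ≫ e.inverse.map f) := by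
  have h := e.counitIso.inv.naturality f
  have h2 := e.counitInv_app_functor X
  rw [Functor.map_comp]
  exact h.trans (congrArg (· ≫ e.functor.map (e.inverse.map f)) h2)

/-- Under `C ≅ N (Γ C)`, a chain map from `N B` to `C` is `N` of its adjoint. For the structure maps
of `C` the adjoints are `gammaMul` and `gammaOne`. -/
lemma incl_toNormalized_map (C : LargeCh R) {B : SMod R} (f : normalized B ⟶ C.complex) (n : ℕ)
    (s : (normalized B).X n) :
    incl (gamma C) n (toNormalized C n ((f.f n).hom s)) =
    (((doldKan R).unitIso.hom.app B ≫ (doldKan R).inverse.map f).app (op ⦋n⦌)).hom (incl _ n s) :=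
      by
  rw [← incl_naturality]
  congr 1
  exact congrArg (fun g => (g.f n).hom s) (comp_counitInv_app (doldKan R) f)

lemma chainMap_mul (C : LargeCh R) [MonObj C] (n : ℕ) (s : (normalized (gamma C ⊗ gamma C)).X n) :
    incl (gamma C) n (toNormalized C n (((LargeCh.chainMap (MonObj.mul (X := C))).f n).hom s)) =
    ((gammaMul C).app (op ⦋n⦌)).hom (incl _ n s) :=
  incl_toNormalized_map C _ n s

lemma chainMap_one (C : LargeCh R) [MonObj C] (n : ℕ) (s : (normalized (𝟙_ (SMod R))).X n) :
    incl (gamma C) n (toNormalized C n (((LargeCh.chainMap (MonObj.one (X := C))).f n).hom s)) =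
    ((gammaOne C).app (op ⦋n⦌)).hom (incl _ n s) :=
  incl_toNormalized_map C _ n s

lemma toNormalized_bijective (C : LargeCh R) (n : ℕ) : Function.Bijective (toNormalized C n) := by
  let e := (HomologicalComplex.eval (ModuleCat.{u} R) _ n).mapIso ((doldKan R).counitIso.symm.app C)
  exact (ConcreteCategory.isIso_iff_bijective e.hom).1 inferInstance

lemma toNormalized_d (C : LargeCh R) (n k : ℕ) (x) :
    toNormalized C k ((C.complex.d n k).hom x) =
      ((normalized (gamma C)).d n k).hom (toNormalized C n x) := by
  exact congrArg (fun g => g.hom x) (((doldKan R).counitIso.inv.app C).comm n k).symm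

lemma homologyπ_surjective (C : LargeCh R) (n : ℕ) :
    Function.Surjective (C.complex.homologyπ n).hom :=
  (ModuleCat.epi_iff_surjective _).1 inferInstance

lemma iCycles_injective (C : LargeCh R) (n : ℕ) : Function.Injective (C.complex.iCycles n).hom :=
  (ModuleCat.mono_iff_injective _).1 inferInstance

lemma exists_iCycles (C : LargeCh R) (n : ℕ) (x : C.complex.X n)
    (h : ∀ k, k + 1 = n → (C.complex.d n k).hom x = 0) :
    ∃ z, (C.complex.iCycles n).hom z = x := by
  let f : ModuleCat.of R R ⟶ C.complex.X n := ModuleCat.ofHom (LinearMap.toSpanSingleton R _ x)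
  have hf : f ≫ C.complex.d n ((ComplexShape.down ℕ).next n) = 0 := by
    ext
    by_cases hn : (ComplexShape.down ℕ).Rel n ((ComplexShape.down ℕ).next n)
    · simpa [f] using h _ hn
    · rw [C.complex.shape _ _ hn]; simp
  refine ⟨(C.complex.liftCycles f _ rfl hf).hom 1, ?_⟩
  have := congrArg (fun g => g.hom (1 : R)) (C.complex.liftCycles_i f _ rfl hf)
  refine this.trans ?_
  simp [f]

lemma d_iCycles (C : LargeCh R) (n k : ℕ) (z : C.complex.cycles n) :
    (C.complex.d n k).hom ((C.complex.iCycles n).hom z) = 0 :=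
  congrArg (fun g => g.hom z) (C.complex.iCycles_d n k)

lemma homologyπ_eq_zero_iff (C : LargeCh R) (n : ℕ) (z : C.complex.cycles n) :
    (C.complex.homologyπ n).hom z = 0 ↔ ∃ y : C.complex.X (n + 1), (C.complex.d (n + 1) n).hom y =
      (C.complex.iCycles n).hom z := by
  have hex : (ShortComplex.mk (C.complex.toCycles (n + 1) n) (C.complex.homologyπ n)
    (by simp)).Exact :=
    ShortComplex.exact_of_g_is_cokernel _ (C.complex.homologyIsCokernel (n + 1) n (by simp))
  rw [ShortComplex.moduleCat_exact_iff] at hex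
  have h1 : ∀ y, (C.complex.iCycles n).hom ((C.complex.toCycles (n + 1) n).hom y) =
    (C.complex.d (n + 1) n).hom y := fun y =>
    congrArg (fun g => g.hom y) (C.complex.toCycles_i (n + 1) n)
  constructor
  · intro h
    obtain ⟨y, hy⟩ := hex z h
    refine ⟨y, ?_⟩
    rw [← h1]
    exact congrArg _ hy
  · rintro ⟨y, hy⟩
    rw [← h1] at hy
    rw [← iCycles_injective C n hy]
    exact congrArg (fun g => g.hom y) (C.complex.toCycles_comp_homologyπ (n + 1) n)

end Glue

/-! ### The degreewise tensor square -/

namespace SimplicialAlgebra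

variable {R : Type u} [CommRing R] {A : ℕ → Type v} [∀ n, CommRing (A n)] [∀ n, Algebra R (A n)]

/-- The degreewise tensor square of a simplicial commutative algebra. -/
def square (X : SimplicialAlgebra R A) : SimplicialAlgebra R (fun n => A n ⊗[R] A n) where
  map f := Algebra.TensorProduct.map (X.map f) (X.map f)
  map_id x := by
    induction x with
    | zero => simp
    | tmul x y => simp [X.map_id]
    | add x y hx hy => rw [map_add, hx, hy]
  map_comp f g x := by
    induction x with
    | zero => simp
    | tmul x y => simp [X.map_comp]
    | add x y hx hy => simp only [map_add, hx, hy]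

lemma tmul_one_mem {X : SimplicialAlgebra R A} {b : Prop} {n : ℕ} {x : A n}
    (hx : x ∈ X.chains b n) : x ⊗ₜ[R] 1 ∈ X.square.chains b n := fun k f j hj hf => by
  simp [square, hx k f j hj hf]

lemma one_tmul_mem {X : SimplicialAlgebra R A} {b : Prop} {n : ℕ} {x : A n}
    (hx : x ∈ X.chains b n) : 1 ⊗ₜ[R] x ∈ X.square.chains b n := fun k f j hj hf => by
  simp [square, hx k f j hj hf]

/-- The shuffle map is itself a shuffle product, of `x ⊗ 1` and `1 ⊗ y` in the tensor square;
`sh_mem` then shows that its values on cycles are normalized. -/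
lemma square_sh (X : SimplicialAlgebra R A) {p q : ℕ} (x : A p) (y : A q) :
    X.square.sh rfl (x ⊗ₜ[R] 1) (1 ⊗ₜ[R] y) =
      ∑ σ ∈ shuffles p q, ((Equiv.Perm.sign σ : ℤˣ) : ℤ) •
        (X.map (stepMap (firstBlock σ) (card_firstBlock σ)) x ⊗ₜ[R]
          X.map (stepMap (secondBlock σ) (card_secondBlock σ)) y) := by
  rw [sh_eq_sum]
  refine Finset.sum_congr rfl fun σ _ => ?_
  simp [square]

end SimplicialAlgebra

/-! ### Comparison of `C` with the simplicial algebra `Γ C` -/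

section Glue

open SimplicialAlgebra

variable {R : Type u} [CommRing R]

/-- The commutative algebra `(Γ C)_n`. -/
def GammaAlg (C : LargeCh R) (n : ℕ) : Type u := (gamma C).obj (op ⦋n⦌)

variable (C : LargeCh R) [MonObj C] [IsCommMonObj C]

instance (n : ℕ) : AddCommGroup (GammaAlg C n) :=
  inferInstanceAs (AddCommGroup ((gamma C).obj (op ⦋n⦌)))

instance (n : ℕ) : Module R (GammaAlg C n) :=
  inferInstanceAs (Module R ((gamma C).obj (op ⦋n⦌)))

instance (n : ℕ) : CommRing (GammaAlg C n) :=
  { (inferInstance : AddCommGroup (GammaAlg C n)) with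
    mul := fun x y => gammaMulLevel C n x y
    one := ((gammaOne C).app (op ⦋n⦌)).hom (1 : R)
    left_distrib := fun x => map_add (gammaMulLevel C n x)
    right_distrib := fun x y z => LinearMap.map_add₂ (gammaMulLevel C n) x y z
    zero_mul := fun x => LinearMap.map_zero₂ (gammaMulLevel C n) x
    mul_zero := fun x => map_zero (gammaMulLevel C n x)
    mul_assoc := gammaMulLevel_assoc C n
    one_mul := gammaMulLevel_one C n
    mul_one := fun x => (gammaMulLevel_comm C n _ _).trans (gammaMulLevel_one C n x)
    mul_comm := gammaMulLevel_comm C n }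

instance (n : ℕ) : Algebra R (GammaAlg C n) :=
  Algebra.ofModule (fun r x y => LinearMap.map_smul₂ (gammaMulLevel C n) r x y)
    (fun r x y => map_smul (gammaMulLevel C n x) r y)

/-- The simplicial commutative algebra `Γ C`. -/
def gammaSimplicial : SimplicialAlgebra R (GammaAlg C) where
  map f := AlgHom.ofLinearMap ((gamma C).map f.op).hom (gammaOne_map C f) (gammaMulLevel_map C f)
  map_id x := congrArg (fun g => g.hom x) ((gamma C).map_id _)
  map_comp f g x := congrArg (fun g => g.hom x) ((gamma C).map_comp g.op f.op)

/-- The inclusion of the normalized chains, with values in the simplicial algebra. -/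
def chainIncl (n : ℕ) : C.complex.X n →ₗ[R] GammaAlg C n := incl (gamma C) n ∘ₗ toNormalized C n

lemma chainIncl_injective (n : ℕ) : Function.Injective (chainIncl C n) :=
  (incl_injective _ n).comp (toNormalized_bijective C n).1

lemma gammaSimplicial_d_chainIncl (n : ℕ) (x : C.complex.X (n + 1)) :
    (gammaSimplicial C).d n (chainIncl C (n + 1) x) = chainIncl C n ((C.complex.d (n + 1) n).hom x) := by
  have h := incl_d (gamma C) n (toNormalized C (n + 1) x)
  rw [← toNormalized_d] at h
  exact h.symm

lemma gammaSimplicial_δ_chainIncl (n : ℕ) (x : C.complex.X (n + 1)) (j : Fin (n + 1)) :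
    (gammaSimplicial C).map (SimplexCategory.δ j.succ) (chainIncl C (n + 1) x) = 0 :=
  incl_face (gamma C) n (toNormalized C (n + 1) x) j

/-- An operator that omits `j` factors through the face `δ j`. -/
lemma map_eq_zero_of_δ {A : ℕ → Type v} [∀ n, CommRing (A n)] [∀ n, Algebra R (A n)]
    (X : SimplicialAlgebra R A) {n k : ℕ} {x : A (n + 1)} {f : ⦋k⦌ ⟶ ⦋n + 1⦌} {j : Fin (n + 2)}
    (hf : ∀ t : Fin (k + 1), f.toOrderHom t ≠ j) (hx : X.map (SimplexCategory.δ j) x = 0) :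
    X.map f x = 0 := by
  obtain ⟨g, rfl⟩ := SimplexCategory.eq_comp_δ_of_not_surjective' f j hf
  exact (X.map_comp g (SimplexCategory.δ j) x).trans (by rw [hx, map_zero])

lemma chainIncl_mem (n : ℕ) (x : C.complex.X n) :
    chainIncl C n x ∈ (gammaSimplicial C).chains False n := by
  intro k f j hj hf
  have hj' : j ≠ 0 := by simpa using hj
  cases n with
  | zero => exact absurd (pos_of_forall_ne hf) (lt_irrefl 0)
  | succ n =>
    obtain ⟨j, rfl⟩ := Fin.exists_succ_eq.mpr hj'
    exact map_eq_zero_of_δ _ hf (gammaSimplicial_δ_chainIncl C n x j)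

lemma exists_chainIncl {n : ℕ} {x : GammaAlg C n} (hx : x ∈ (gammaSimplicial C).chains False n) :
    ∃ w, chainIncl C n w = x := by
  have h : ∃ w, incl (gamma C) n w = x := by
    cases n with
    | zero => exact exists_incl_zero _ _
    | succ n =>
      exact exists_incl _ _ _ fun j => hx _ (SimplexCategory.δ j.succ) j.succ
        (Or.inr (Fin.succ_ne_zero j)) (Fin.succAbove_ne j.succ)
  obtain ⟨w, hw⟩ := h
  obtain ⟨v, rfl⟩ := (toNormalized_bijective C n).2 w
  exact ⟨v, hw⟩

/-- The faces other than the zeroth vanish on normalized chains, and the zeroth is the differential.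
In degree `0` both sides hold vacuously. -/
lemma chainIncl_mem_cycles_iff (n : ℕ) (x : C.complex.X n) :
    chainIncl C n x ∈ (gammaSimplicial C).cycles n ↔
      ∀ k, k + 1 = n → (C.complex.d n k).hom x = 0 := by
  constructor
  · rintro hx k rfl
    refine chainIncl_injective C k ?_
    rw [map_zero, ← gammaSimplicial_d_chainIncl]
    exact hx _ _ 0 (Or.inl trivial) δ_zero_ne
  · intro hx k f j _ hf
    by_cases hj : j = 0
    · subst hj
      cases n with
      | zero => exact absurd (pos_of_forall_ne hf) (lt_irrefl 0)
      | succ n =>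
        refine map_eq_zero_of_δ _ hf ?_
        have := gammaSimplicial_d_chainIncl C n x
        rwa [hx n rfl, map_zero] at this
    · exact chainIncl_mem C n x k f j (Or.inr hj) hf

/-- The cycles of `C` as cycles of the simplicial algebra. -/
def cyclesEquiv (n : ℕ) : C.complex.cycles n ≃ₗ[R] (gammaSimplicial C).cycles n :=
  LinearEquiv.ofBijective
    (LinearMap.codRestrict _ (chainIncl C n ∘ₗ (C.complex.iCycles n).hom) fun z =>
      (chainIncl_mem_cycles_iff C n _).mpr fun k _ => d_iCycles C n k z)
    ⟨fun z w h => iCycles_injective C n (chainIncl_injective C n (congrArg Subtype.val h)),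
      fun y => by
        obtain ⟨x, hx⟩ := exists_chainIncl C (chains_le False n y.2)
        obtain ⟨z, rfl⟩ := exists_iCycles C n x
          ((chainIncl_mem_cycles_iff C n x).mp (by rw [hx]; exact y.2))
        exact ⟨z, Subtype.ext hx⟩⟩

lemma cyclesEquiv_coe (n : ℕ) (z : C.complex.cycles n) :
    (cyclesEquiv C n z : GammaAlg C n) = chainIncl C n ((C.complex.iCycles n).hom z) := rfl

/-- The homology of `C` as the homology of the simplicial algebra. -/
def gammaHomology : (gammaSimplicial C).HomologyData (fun n => H C n) where
  π n := (C.complex.homologyπ n).hom ∘ₗ (cyclesEquiv C n).symm.toLinearMap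
  π_surjective n := (homologyπ_surjective C n).comp (cyclesEquiv C n).symm.surjective
  π_eq_zero_iff := by
    intro n x
    obtain ⟨z, rfl⟩ := (cyclesEquiv C n).surjective x
    refine Iff.trans (b := (C.complex.homologyπ n).hom z = 0) ?_ ?_
    · rw [LinearMap.comp_apply, LinearEquiv.coe_coe, LinearEquiv.symm_apply_apply]
    rw [homologyπ_eq_zero_iff, cyclesEquiv_coe]
    constructor
    · rintro ⟨y, hy⟩
      exact ⟨chainIncl C (n + 1) y, chainIncl_mem C _ y, by rw [gammaSimplicial_d_chainIncl, hy]⟩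
    · rintro ⟨y, hy, hd⟩
      obtain ⟨y, rfl⟩ := exists_chainIncl C hy
      rw [gammaSimplicial_d_chainIncl] at hd
      exact ⟨y, chainIncl_injective C n hd⟩

lemma represents_iff {n : ℕ} (x : C.complex.X n) (a : H C n) : Represents C x a ↔
    ∃ z : (gammaSimplicial C).cycles n, chainIncl C n x = z ∧ (gammaHomology C).π n z = a := by
  constructor
  · rintro ⟨z, rfl, rfl⟩
    refine ⟨cyclesEquiv C n z, rfl, ?_⟩
    exact congrArg (fun y => (C.complex.homologyπ n).hom y) ((cyclesEquiv C n).symm_apply_apply z)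
  · rintro ⟨z, hx, rfl⟩
    refine ⟨(cyclesEquiv C n).symm z, chainIncl_injective C n ?_, rfl⟩
    rw [hx, ← cyclesEquiv_coe, LinearEquiv.apply_symm_apply]

lemma exists_isShuffle {p q : ℕ} {x : C.complex.X p} {y : C.complex.X q}
    {z : (gammaSimplicial C).cycles p} {w : (gammaSimplicial C).cycles q}
    (hx : chainIncl C p x = z) (hy : chainIncl C q y = w) :
    ∃ s : (normalized (gamma C ⊗ gamma C)).X (p + q),
      IsShuffle (toNormalized C p x) (toNormalized C q y) s := by
  have hmem := sh_mem rfl (tmul_one_mem z.2) (one_tmul_mem w.2)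
  have hface : ∀ (k n : ℕ) (f : ⦋k⦌ ⟶ ⦋n⦌) (v : GammaAlg C n ⊗[R] GammaAlg C n),
      ((gamma C ⊗ gamma C).map f.op).hom v = (gammaSimplicial C).square.map f v := by
    intro k n f v
    induction v with
    | zero => rw [map_zero]; exact map_zero _
    | tmul a b => rfl
    | add a b ha hb => rw [map_add, ← ha, ← hb]; exact map_add _ a b
  obtain ⟨s, hs⟩ : ∃ s, incl (gamma C ⊗ gamma C) (p + q) s = (gammaSimplicial C).square.sh rfl
      ((z : GammaAlg C p) ⊗ₜ[R] (1 : GammaAlg C p)) ((1 : GammaAlg C q) ⊗ₜ[R] (w : GammaAlg C q)) := by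
    -- The degree `p + q` must become a variable before it can be split into zero and successor.
    generalize (gammaSimplicial C).square.sh rfl ((z : GammaAlg C p) ⊗ₜ[R] (1 : GammaAlg C p))
      ((1 : GammaAlg C q) ⊗ₜ[R] (w : GammaAlg C q)) = v at hmem
    generalize p + q = m at v hmem
    cases m with
    | zero => exact exists_incl_zero _ _
    | succ n =>
      refine exists_incl _ _ _ fun j => ?_
      refine (hface _ _ (SimplexCategory.δ j.succ) v).trans ?_
      exact hmem _ (SimplexCategory.δ j.succ) j.succ (Or.inl trivial) (Fin.succAbove_ne j.succ)
  refine ⟨s, hs.trans ?_⟩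
  rw [square_sh, ← hx, ← hy]
  rfl

lemma gammaMul_incl_isShuffle {p q : ℕ} {x : C.complex.X p} {y : C.complex.X q}
    {s : (normalized (gamma C ⊗ gamma C)).X (p + q)}
    (hs : IsShuffle (toNormalized C p x) (toNormalized C q y) s) :
    ((gammaMul C).app (op ⦋p + q⦌)).hom (incl _ (p + q) s) =
      (gammaSimplicial C).sh rfl (chainIncl C p x) (chainIncl C q y) := by
  rw [sh_eq_sum]
  refine (congrArg ((gammaMul C).app (op ⦋p + q⦌)).hom hs).trans ?_
  refine (map_sum ((gammaMul C).app (op ⦋p + q⦌)).hom _ _).trans ?_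
  refine Finset.sum_congr rfl fun σ _ => ?_
  exact map_zsmul ((gammaMul C).app (op ⦋p + q⦌)).hom _ _

lemma isInducedAlgebra : IsInducedAlgebra C (gammaHomology C).algebra where
  one := by
    obtain ⟨e, he⟩ := exists_incl_zero (𝟙_ (SMod R)) (1 : R)
    refine ⟨e, he, (represents_iff C _ _).mpr ⟨HomologyData.oneCycle _, ?_, rfl⟩⟩
    refine (chainMap_one C 0 e).trans ?_
    rw [he]
    rfl
  mul := by
    intro p q x y a b ha hb
    obtain ⟨z, hz, rfl⟩ := (represents_iff C x a).mp ha
    obtain ⟨w, hw, rfl⟩ := (represents_iff C y b).mp hb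
    obtain ⟨s, hs⟩ := exists_isShuffle C hz hw
    refine ⟨s, hs, (represents_iff C _ _).mpr ⟨(gammaSimplicial C).shCycles rfl z w, ?_, ?_⟩⟩
    · refine (chainMap_mul C _ s).trans ((gammaMul_incl_isShuffle C hs).trans ?_)
      rw [hz, hw]
      rfl
    · exact ((gammaHomology C).algebra_mul rfl z w).symm

lemma dividedPowerSum_eq (i : ℕ) {n : ℕ} (hn : 0 < n) (he : Even n) (x : GammaAlg C n) :
    dividedPowerSum C i hn x = (gammaSimplicial C).dpow i rfl x := by
  rw [dpow_eq_sum _ i hn he]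
  rfl

lemma isInducedDividedPowers : IsInducedDividedPowers C (gammaHomology C).dividedPowers := by
  intro i n hn he x a ha
  obtain ⟨z, hz, rfl⟩ := (represents_iff C x a).mp ha
  obtain ⟨w, hw⟩ := exists_chainIncl C
    (chains_le False _ ((gammaSimplicial C).dpowCycles i hn rfl z).2)
  refine ⟨w, ?_, (represents_iff C _ _).mpr ⟨_, hw, ?_⟩⟩
  · refine hw.trans ?_
    refine Eq.trans ?_ (dividedPowerSum_eq C i hn he (chainIncl C n x)).symm
    rw [hz]
    rfl
  · exact ((gammaHomology C).γ_π i hn rfl z).symm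

end Glue

end LargeTensor

end

open CategoryTheory LargeTensor in
theorem mainTheorem2 {R : Type u} [CommRing R] (C : CommMon (LargeCh R)) :
    ∃ 𝒜 : GradedCommAlgebra R (fun n => H C.X n),
      IsInducedAlgebra C.X 𝒜 ∧
        ∃ D : GradedDividedPowers 𝒜, IsInducedDividedPowers C.X D :=
  ⟨_, isInducedAlgebra C.X, _, isInducedDividedPowers C.X⟩
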